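/- Let $I=[c,d)$ with $c<d$ be a bounded interval, let $D(J)$ denote the family of all dyadic subintervals of an interval $J$ (including $J$ itself), and let $\langle\varphi\rangle_J=\frac1{|J|}\int_J\varphi(t)\,dt$. Let $0\le m\le M$ and $$\Omega=\{x=(x_1,x_2,x_3)\in\mathbb R^3:\ x_1^2\le x_2,\ m\le x_3\le M\}.$$ For $x\in\Omega$ define the lower Carleson Bellman function by $$\mathbf B_{\min}(x;m,M)=\inf\ \frac1{|I|}\Big(\int_I|\varphi|^2\,d\mu+\sum_{J\in D(I)}|\langle\varphi\rangle_J|^2\,\alpha_J\Big),$$ where the infimum is taken over all real-valued $\varphi\in L^2(I)$, all non-negative atomless Borel measures $\mu$ on $I$ and all families of numbers $\alpha_J\ge0$ $(J\in D(I))$ such that $$\langle\varphi\rangle_I=x_1,\qquad \langle\varphi^2\rangle_I=x_2,\qquad \frac1{|I|}\Big(\mu(I)+\sum_{J\in D(I)}\alpha_J\Big)=x_3,$$ $$m|J|\le\mu(J)+\sum_{\ell\in D(J)}\alpha_\ell\le M|J|\qquad\text{for all }J\in D(I).$$ Let $x\in\Omega$. (i) Suppose $x_2>0$ and $M-(M-m)\frac{x_1^2}{x_2}<x_3\le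 M$. Then the equation $$\frac{x_1^2}{x_2}=\left[\frac{1-2a(M-x_3)}{1-2a(M-m)}\right]^2\frac{1-4a(M-m)}{1-4a(M-x_3)}$$ has exactly one solution $a=a^-(x)$ in $(-\infty,0]$; it is negative if $x_1^2<x_2$ and equals $0$ if $x_1^2=x_2$. With this $a$, $$\mathbf B_{\min}(x;m,M)=\frac{(x_3-m)\,x_2}{[1-2a(M-m)]^2\,[1-4a(M-x_3)]}+m\,x_2 .$$ (ii) Suppose $x_2>0$ and $m\le x_3\le M-(M-m)\frac{x_1^2}{x_2}$. Then $\mathbf B_{\min}(x;m,M)=m\,x_2$. (iii) If $x_2=0$ (hence $x_1=0$), then $\mathbf B_{\min}(x;m,M)=0$. -/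

import Mathlib

open MeasureTheory
open scoped NNReal ENNReal

noncomputable section

namespace CarlesonBellman

/-- Indices of the dyadic subintervals of a fixed interval: the pair `⟨n, k⟩` stands for
the `k`-th of the `2 ^ n` intervals of generation `n` (the interval itself is `⟨0, 0⟩`). -/
abbrev Dyadic : Type := Σ n : ℕ, Fin (2 ^ n)

/-- The dyadic subinterval of `[c, d)` with index `J`. Endpoints play no role, since
neither Lebesgue measure nor the measures considered below have atoms. -/
def interval (c d : ℝ) (J : Dyadic) : Set ℝ :=
  Set.Ico (c + (J.2 : ℕ) * ((d - c) / 2 ^ J.1)) (c + ((J.2 : ℕ) + 1) * ((d - c) / 2 ^ J.1))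

/-- The average of `f` over `J` with respect to Lebesgue measure. -/
def avg (c d : ℝ) (f : ℝ → ℝ) (J : Dyadic) : ℝ :=
  ⨍ t in interval c d J, f t

/-- The total mass `μ(J) + ∑_{ℓ ∈ D(J)} α_ℓ` carried by the dyadic interval `J`, where `D(J)`
is the family of all dyadic subintervals of `J` (including `J` itself). -/
def mass (c d : ℝ) (μ : Measure ℝ) (α : Dyadic → ℝ≥0) (J : Dyadic) : ℝ≥0∞ :=
  μ (interval c d J) + ∑' l : {l : Dyadic // interval c d l ⊆ interval c d J}, (α l : ℝ≥0∞)

/-- The test function `φ`, the non-negative atomless measure `μ` and the non-negative numbers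
`α_J` compete in the extremal problem at `(x₁, x₂, x₃)` on the interval `I = [c, d)`. Only the
restrictions of `φ` and `μ` to `I` matter. -/
structure Admissible (c d m M x₁ x₂ x₃ : ℝ) (φ : ℝ → ℝ) (μ : Measure ℝ)
    (α : Dyadic → ℝ≥0) : Prop where
  memLp : MemLp φ 2 (volume.restrict (Set.Ico c d))
  noAtoms : ∀ t : ℝ, μ {t} = 0
  avg_eq : ⨍ t in Set.Ico c d, φ t = x₁
  avg_sq_eq : ⨍ t in Set.Ico c d, φ t ^ 2 = x₂
  mass_eq : (μ (Set.Ico c d) + ∑' J, (α J : ℝ≥0∞)) / volume (Set.Ico c d) = ENNReal.ofReal x₃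
  le_mass : ∀ J, ENNReal.ofReal m * volume (interval c d J) ≤ mass c d μ α J
  mass_le : ∀ J, mass c d μ α J ≤ ENNReal.ofReal M * volume (interval c d J)

/-- The quantity `|I|⁻¹ (∫_I φ² dμ + ∑_{J ∈ D(I)} ⟨φ⟩_J² α_J)` to be minimized. -/
def functional (c d : ℝ) (φ : ℝ → ℝ) (μ : Measure ℝ) (α : Dyadic → ℝ≥0) : ℝ≥0∞ :=
  (∫⁻ t in Set.Ico c d, ENNReal.ofReal (φ t ^ 2) ∂μ +
    ∑' J, ENNReal.ofReal (avg c d φ J ^ 2) * (α J : ℝ≥0∞)) / volume (Set.Ico c d)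

/-- The lower Bellman function of the dyadic Carleson embedding theorem on `I = [c, d)`. The
infimum is taken in `[0, ∞]`; it would be `∞` if there were no competitors. -/
def Bmin (c d m M x₁ x₂ x₃ : ℝ) : ℝ≥0∞ :=
  ⨅ (φ : ℝ → ℝ) (μ : Measure ℝ) (α : Dyadic → ℝ≥0) (_ : Admissible c d m M x₁ x₂ x₃ φ μ α),
    functional c d φ μ α

/-- The cubic equation for `a`. -/
def Cubic (m M x₁ x₂ x₃ a : ℝ) : Prop :=
  x₁ ^ 2 / x₂ = ((1 - 2 * a * (M - x₃)) / (1 - 2 * a * (M - m))) ^ 2 *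
    ((1 - 4 * a * (M - m)) / (1 - 4 * a * (M - x₃)))

/-- The candidate `B(x₁, x₂, x₃; m, M)`, as a function of the root `a` of the cubic. -/
def B (m M x₂ x₃ a : ℝ) : ℝ :=
  (x₃ - m) * x₂ / ((1 - 2 * a * (M - m)) ^ 2 * (1 - 4 * a * (M - x₃))) + m * x₂

end CarlesonBellman

end

/-!
Restricting a competitor to the two halves of an interval, and conversely concatenating
competitors on the halves, shows that the lower Bellman function is midpoint convex on `Ω`; a
number `α_I` at the top interval adds the jump inequality `G (x₁, x₂, x₃ + a) ≤ G x + a x₁²`.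
Since constant competitors bound it by `x₂ x₃`, it is then genuinely convex. Conversely, every
convex function that satisfies the jump inequality and is at most `x₂ x₃` lies below it: iterate
the two inequalities down the dyadic tree, and let the generation tend to infinity.

The domain is foliated by segments from the face `x₃ = M` to the curve `x₁² = x₂`, `x₃ = m`. The
Bellman function is bounded above by convexity along such a segment; its value at the end in the
face `x₃ = M` is controlled by stepping a little off the face along a segment to the curve and
jumping back, which compares that value with a multiple of itself by homogeneity in the test
function. It is bounded below by the functions
`m x₂ + (x₁² / (1 + s (M - x₃)) - x₂ / (1 + s (M - m))) / s`, each of which attains the upper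
bound along the segments with parameter `s`. In the remaining region the segments join `(0, 0, M)`
to the face `x₃ = m`, and the bound is `m x₂`.
-/

namespace CarlesonBellman

open Filter Set Topology

/-- The index of the whole interval. -/
def root : Dyadic := ⟨0, 0⟩

/-- The index, as a dyadic subinterval of `[c, d)`, of the interval with index `J` among the dyadic
subintervals of the left half of `[c, d)`. -/
def ofLeft (J : Dyadic) : Dyadic :=
  ⟨J.1 + 1, ⟨J.2, by have := J.2.2; rw [pow_succ]; omega⟩⟩

/-- The index, as a dyadic subinterval of `[c, d)`, of the interval with index `J` among the dyadic
subintervals of the right half of `[c, d)`. -/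
def ofRight (J : Dyadic) : Dyadic :=
  ⟨J.1 + 1, ⟨2 ^ J.1 + J.2, by have := J.2.2; rw [pow_succ]; omega⟩⟩

/-! ### Dyadic intervals and their halves -/

theorem eq_root_or_exists_eq_ofLeft_or_ofRight (J : Dyadic) :
    J = root ∨ (∃ K, J = ofLeft K) ∨ ∃ K, J = ofRight K := by
  obtain ⟨n, k, hk⟩ := J
  cases n with
  | zero =>
    obtain rfl : k = 0 := by simpa using hk
    exact Or.inl rfl
  | succ n =>
    right
    by_cases h : k < 2 ^ n
    · exact Or.inl ⟨⟨n, k, h⟩, rfl⟩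
    · refine Or.inr ⟨⟨n, k - 2 ^ n, by rw [pow_succ] at hk; omega⟩, ?_⟩
      simp only [ofRight, Sigma.mk.injEq, heq_eq_eq, Fin.mk.injEq, true_and]
      omega

theorem sum_generation_succ {β : Type*} [AddCommMonoid β] (f : Dyadic → β) (n : ℕ) :
    ∑ k, f ⟨n + 1, k⟩ = ∑ k, f (ofLeft ⟨n, k⟩) + ∑ k, f (ofRight ⟨n, k⟩) := by
  have two_mul_pow : 2 ^ n + 2 ^ n = 2 ^ (n + 1) := by ring
  rw [← Equiv.sum_comp (finCongr two_mul_pow), Fin.sum_univ_add]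
  rfl

theorem tsum_dyadic (f : Dyadic → ℝ≥0∞) :
    ∑' J, f J = f root + (∑' J, f (ofLeft J) + ∑' J, f (ofRight J)) := by
  simp_rw [ENNReal.tsum_sigma', tsum_fintype]
  rw [← ENNReal.tsum_add, tsum_eq_zero_add' ENNReal.summable]
  congr 1
  · exact Fin.sum_univ_one fun k : Fin 1 => f ⟨0, k⟩
  · exact tsum_congr (sum_generation_succ f)

section

variable {c d : ℝ}

theorem interval_root (c d : ℝ) : interval c d root = Ico c d := by
  simp [interval, root]

theorem interval_ofLeft (c d : ℝ) (J : Dyadic) :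
    interval c d (ofLeft J) = interval c ((c + d) / 2) J := by
  have length_eq : (d - c) / 2 ^ (J.1 + 1) = ((c + d) / 2 - c) / 2 ^ J.1 := by
    rw [pow_succ]; field_simp; ring
  simp only [interval, ofLeft, length_eq]

theorem interval_ofRight (c d : ℝ) (J : Dyadic) :
    interval c d (ofRight J) = interval ((c + d) / 2) d J := by
  have length_eq : (d - c) / 2 ^ (J.1 + 1) = (d - (c + d) / 2) / 2 ^ J.1 := by
    rw [pow_succ]; field_simp; ring
  simp only [interval, ofRight, length_eq]
  push_cast
  congr 1 <;> field_simp <;> ring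

theorem volume_interval (c d : ℝ) (J : Dyadic) :
    volume (interval c d J) = ENNReal.ofReal ((d - c) / 2 ^ J.1) := by
  rw [interval, Real.volume_Ico]
  congr 1; ring

theorem measurableSet_interval (c d : ℝ) (J : Dyadic) : MeasurableSet (interval c d J) :=
  measurableSet_Ico

theorem interval_subset_Ico (hcd : c ≤ d) (J : Dyadic) : interval c d J ⊆ Ico c d := by
  have : 0 ≤ (d - c) / 2 ^ J.1 := div_nonneg (sub_nonneg.2 hcd) (by positivity)
  have index_le : ((J.2 : ℕ) : ℝ) + 1 ≤ 2 ^ J.1 := by exact_mod_cast J.2.2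
  refine Ico_subset_Ico (le_add_of_nonneg_right (by positivity)) ?_
  calc c + ((J.2 : ℕ) + 1) * ((d - c) / 2 ^ J.1) ≤ c + 2 ^ J.1 * ((d - c) / 2 ^ J.1) := by gcongr
    _ = d := by field_simp; ring

theorem interval_nonempty (hcd : c < d) (J : Dyadic) : (interval c d J).Nonempty := by
  have : 0 < (d - c) / 2 ^ J.1 := div_pos (sub_pos.2 hcd) (by positivity)
  exact nonempty_Ico.2 (by gcongr; exact lt_add_one _)

theorem interval_subset_ball {t : ℝ} {J : Dyadic} (ht : t ∈ interval c d J) :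
    interval c d J ⊆ Metric.ball t ((d - c) / 2 ^ J.1) := by
  rintro s ⟨hs₁, hs₂⟩
  obtain ⟨ht₁, ht₂⟩ := ht
  rw [Metric.mem_ball, Real.dist_eq, abs_lt]
  constructor <;> linarith

theorem pairwise_disjoint_interval (c d : ℝ) (n : ℕ) :
    Pairwise (Function.onFun Disjoint fun k : Fin (2 ^ n) => interval c d ⟨n, k⟩) := by
  refine fun j k hjk => ?_
  have indices_ne : ((j : ℕ) : ℤ) ≠ (k : ℕ) := by exact_mod_cast Fin.val_ne_of_ne hjk
  simpa [Function.onFun, interval] using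
    pairwise_disjoint_Ico_add_zsmul c ((d - c) / 2 ^ n) indices_ne

theorem Ico_union_half (hcd : c < d) : Ico c ((c + d) / 2) ∪ Ico ((c + d) / 2) d = Ico c d :=
  Ico_union_Ico_eq_Ico (left_lt_add_div_two.2 hcd).le (add_div_two_lt_right.2 hcd).le

theorem exists_mem_interval (hcd : c < d) (n : ℕ) {t : ℝ} (ht : t ∈ Ico c d) :
    ∃ k, t ∈ interval c d ⟨n, k⟩ := by
  induction n generalizing c d with
  | zero => exact ⟨root.2, (interval_root c d).symm ▸ ht⟩
  | succ n ih =>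
    rw [← Ico_union_half hcd] at ht
    rcases ht with ht | ht
    · obtain ⟨k, hk⟩ := ih (left_lt_add_div_two.2 hcd) ht
      exact ⟨(ofLeft ⟨n, k⟩).2, interval_ofLeft c d ⟨n, k⟩ ▸ hk⟩
    · obtain ⟨k, hk⟩ := ih (add_div_two_lt_right.2 hcd) ht
      exact ⟨(ofRight ⟨n, k⟩).2, interval_ofRight c d ⟨n, k⟩ ▸ hk⟩

theorem iUnion_interval (hcd : c < d) (n : ℕ) : ⋃ k, interval c d ⟨n, k⟩ = Ico c d :=
  (iUnion_subset fun _ => interval_subset_Ico hcd.le _).antisymm fun _ ht =>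
    mem_iUnion.2 (exists_mem_interval hcd n ht)

/-! ### Masses and averages over dyadic intervals -/

theorem measure_Ico_half (hcd : c < d) (μ : Measure ℝ) :
    μ (Ico c d) = μ (Ico c ((c + d) / 2)) + μ (Ico ((c + d) / 2) d) := by
  rw [← Ico_union_half hcd, measure_union Ico_disjoint_Ico_same measurableSet_Ico]

theorem mass_eq_tsum_indicator (c d : ℝ) (μ : Measure ℝ) (α : Dyadic → ℝ≥0) (J : Dyadic) :
    mass c d μ α J = μ (interval c d J) +
      ∑' l, indicator {l | interval c d l ⊆ interval c d J} (fun l => (α l : ℝ≥0∞)) l := by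
  rw [← tsum_subtype]; rfl

theorem mass_root (hcd : c ≤ d) (μ : Measure ℝ) (α : Dyadic → ℝ≥0) :
    mass c d μ α root = μ (Ico c d) + ∑' J, (α J : ℝ≥0∞) := by
  rw [mass_eq_tsum_indicator, interval_root]
  congr 1
  exact tsum_congr fun l => indicator_of_mem (interval_subset_Ico hcd l) _

theorem interval_ofLeft_subset (hcd : c < d) (J : Dyadic) :
    interval c d (ofLeft J) ⊆ Ico c ((c + d) / 2) :=
  interval_ofLeft c d J ▸ interval_subset_Ico (left_lt_add_div_two.2 hcd).le J

theorem interval_ofRight_subset (hcd : c < d) (J : Dyadic) :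
    interval c d (ofRight J) ⊆ Ico ((c + d) / 2) d :=
  interval_ofRight c d J ▸ interval_subset_Ico (add_div_two_lt_right.2 hcd).le J

theorem disjoint_interval_ofLeft_ofRight (hcd : c < d) (J K : Dyadic) :
    Disjoint (interval c d (ofLeft J)) (interval c d (ofRight K)) :=
  Ico_disjoint_Ico_same.mono (interval_ofLeft_subset hcd J) (interval_ofRight_subset hcd K)

theorem not_interval_root_subset_ofLeft (hcd : c < d) (J : Dyadic) :
    ¬interval c d root ⊆ interval c d (ofLeft J) := by
  intro h
  rw [interval_root] at h
  exact (h.trans (interval_ofLeft_subset hcd J)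
    ⟨(left_lt_add_div_two.2 hcd).le, add_div_two_lt_right.2 hcd⟩).2.false

theorem not_interval_root_subset_ofRight (hcd : c < d) (J : Dyadic) :
    ¬interval c d root ⊆ interval c d (ofRight J) := by
  intro h
  rw [interval_root] at h
  exact (h.trans (interval_ofRight_subset hcd J) (left_mem_Ico.2 hcd)).1.not_gt
    (left_lt_add_div_two.2 hcd)

theorem not_interval_ofRight_subset_ofLeft (hcd : c < d) (J K : Dyadic) :
    ¬interval c d (ofRight K) ⊆ interval c d (ofLeft J) := fun h =>
  (interval_nonempty hcd (ofRight K)).ne_empty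
    ((disjoint_interval_ofLeft_ofRight hcd J K).eq_bot_of_ge h)

theorem not_interval_ofLeft_subset_ofRight (hcd : c < d) (J K : Dyadic) :
    ¬interval c d (ofLeft K) ⊆ interval c d (ofRight J) := fun h =>
  (interval_nonempty hcd (ofLeft K)).ne_empty
    ((disjoint_interval_ofLeft_ofRight hcd K J).eq_bot_of_le h)

open Classical in
theorem mass_ofLeft (hcd : c < d) (μ : Measure ℝ) (α : Dyadic → ℝ≥0) (J : Dyadic) :
    mass c d μ α (ofLeft J) = mass c ((c + d) / 2) μ (α ∘ ofLeft) J := by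
  rw [mass_eq_tsum_indicator, mass_eq_tsum_indicator, tsum_dyadic,
    indicator_of_notMem (not_interval_root_subset_ofLeft hcd J)]
  simp only [indicator_apply, mem_ofPred_eq, not_interval_ofRight_subset_ofLeft hcd, if_false,
    tsum_zero, zero_add, add_zero]
  simp only [interval_ofLeft, Function.comp]

open Classical in
theorem mass_ofRight (hcd : c < d) (μ : Measure ℝ) (α : Dyadic → ℝ≥0) (J : Dyadic) :
    mass c d μ α (ofRight J) = mass ((c + d) / 2) d μ (α ∘ ofRight) J := by
  rw [mass_eq_tsum_indicator, mass_eq_tsum_indicator, tsum_dyadic,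
    indicator_of_notMem (not_interval_root_subset_ofRight hcd J)]
  simp only [indicator_apply, mem_ofPred_eq, not_interval_ofLeft_subset_ofRight hcd, if_false,
    tsum_zero, zero_add]
  simp only [interval_ofRight, Function.comp]

theorem mass_root_eq_add (hcd : c < d) (μ : Measure ℝ) (α : Dyadic → ℝ≥0) :
    mass c d μ α root = α root + (mass c ((c + d) / 2) μ (α ∘ ofLeft) root +
      mass ((c + d) / 2) d μ (α ∘ ofRight) root) := by
  rw [mass_root hcd.le, mass_root (left_lt_add_div_two.2 hcd).le,
    mass_root (add_div_two_lt_right.2 hcd).le, tsum_dyadic, measure_Ico_half hcd]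
  simp only [Function.comp]
  ring

theorem avg_root (c d : ℝ) (f : ℝ → ℝ) : avg c d f root = ⨍ t in Ico c d, f t := by
  rw [avg, interval_root]

theorem avg_ofLeft (c d : ℝ) (f : ℝ → ℝ) (J : Dyadic) :
    avg c d f (ofLeft J) = avg c ((c + d) / 2) f J := by
  rw [avg, avg, interval_ofLeft]

theorem avg_ofRight (c d : ℝ) (f : ℝ → ℝ) (J : Dyadic) :
    avg c d f (ofRight J) = avg ((c + d) / 2) d f J := by
  rw [avg, avg, interval_ofRight]

theorem average_half (hcd : c < d) {f : ℝ → ℝ} (hf : IntegrableOn f (Ico c d)) :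
    ⨍ t in Ico c d, f t =
      ((⨍ t in Ico c ((c + d) / 2), f t) + ⨍ t in Ico ((c + d) / 2) d, f t) / 2 := by
  have integral_half : ∫ t in Ico c d, f t =
      (∫ t in Ico c ((c + d) / 2), f t) + ∫ t in Ico ((c + d) / 2) d, f t := by
    rw [← Ico_union_half hcd] at hf ⊢
    exact setIntegral_union Ico_disjoint_Ico_same measurableSet_Ico
      (hf.mono_set subset_union_left) (hf.mono_set subset_union_right)
  have length_left : (c + d) / 2 - c = (d - c) / 2 := by ring
  have length_right : d - (c + d) / 2 = (d - c) / 2 := by ring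
  simp only [setAverage_eq, Real.volume_real_Ico_of_le hcd.le,
    Real.volume_real_Ico_of_le (left_lt_add_div_two.2 hcd).le,
    Real.volume_real_Ico_of_le (add_div_two_lt_right.2 hcd).le, length_left, length_right,
    integral_half, smul_eq_mul]
  field_simp

end

/-! ### Comparison of measures on dyadic intervals -/

section

variable {c d : ℝ} {μ ν : Measure ℝ} {α : Dyadic → ℝ≥0}

theorem tendsto_div_two_pow (x : ℝ) : Tendsto (fun n : ℕ => x / 2 ^ n) atTop (𝓝 0) :=
  tendsto_const_nhds.div_atTop (tendsto_pow_atTop_atTop_of_one_lt one_lt_two)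

theorem measure_inter_Ico_le_of_isOpen (hcd : c < d)
    (h : ∀ J, μ (interval c d J) ≤ ν (interval c d J)) {U : Set ℝ} (hU : IsOpen U) :
    μ (U ∩ Ico c d) ≤ ν U := by
  classical
  let inner (n : ℕ) : Set ℝ := {t | Metric.ball t ((d - c) / 2 ^ n) ⊆ U} ∩ Ico c d
  have inner_mono : Monotone inner := by
    refine fun m n hmn => inter_subset_inter_left _ fun t ht => ?_
    refine (Metric.ball_subset_ball ?_).trans ht
    have := sub_nonneg.2 hcd.le
    gcongr
    exact one_le_two
  have inter_subset_iUnion_inner : U ∩ Ico c d ⊆ ⋃ n, inner n := by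
    rintro t ⟨htU, ht⟩
    obtain ⟨ε, hε, hball⟩ := Metric.isOpen_iff.1 hU t htU
    obtain ⟨n, hn⟩ := ((tendsto_div_two_pow (d - c)).eventually_lt_const hε).exists
    exact mem_iUnion.2 ⟨n, (Metric.ball_subset_ball hn.le).trans hball, ht⟩
  have measure_inner_le (n : ℕ) : μ (inner n) ≤ ν U := by
    let S := Finset.univ.filter fun k => interval c d ⟨n, k⟩ ⊆ U
    calc μ (inner n) ≤ μ (⋃ k ∈ S, interval c d ⟨n, k⟩) := by
          refine measure_mono fun t ⟨hball, ht⟩ => ?_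
          obtain ⟨k, hk⟩ := exists_mem_interval hcd n ht
          have := (interval_subset_ball hk).trans hball
          exact mem_iUnion₂.2 ⟨k, by simpa [S] using this, hk⟩
      _ ≤ ∑ k ∈ S, μ (interval c d ⟨n, k⟩) := measure_biUnion_finset_le _ _
      _ ≤ ∑ k ∈ S, ν (interval c d ⟨n, k⟩) := Finset.sum_le_sum fun k _ => h _
      _ = ν (⋃ k ∈ S, interval c d ⟨n, k⟩) :=
          (measure_biUnion_finset (fun _ _ _ _ hjk => pairwise_disjoint_interval c d n hjk)
            fun _ _ => measurableSet_interval _ _ _).symm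
      _ ≤ ν U := measure_mono (iUnion₂_subset fun k hk => (Finset.mem_filter.1 hk).2)
  calc μ (U ∩ Ico c d) ≤ μ (⋃ n, inner n) := measure_mono inter_subset_iUnion_inner
    _ = ⨆ n, μ (inner n) := inner_mono.measure_iUnion
    _ ≤ ν U := iSup_le measure_inner_le

theorem restrict_Ico_le_restrict [ν.OuterRegular] (hcd : c < d)
    (h : ∀ J, μ (interval c d J) ≤ ν (interval c d J)) :
    μ.restrict (Ico c d) ≤ ν.restrict (Ico c d) := by
  refine Measure.le_iff.2 fun s hs => ?_
  rw [Measure.restrict_apply hs, Measure.restrict_apply hs, (s ∩ Ico c d).measure_eq_iInf_isOpen ν]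
  refine le_iInf₂ fun U hsU => le_iInf fun hU => ?_
  exact (measure_mono (subset_inter hsU inter_subset_right)).trans
    (measure_inter_Ico_le_of_isOpen hcd h hU)

/-! ### Sums over the dyadic intervals of one generation -/

/-- The total mass of the numbers `α J` over the generations from `n` on. -/
noncomputable def tail (n : ℕ) (α : Dyadic → ℝ≥0) : ℝ≥0∞ :=
  ∑' J : Dyadic, if n ≤ J.1 then (α J : ℝ≥0∞) else 0

theorem tail_zero (α : Dyadic → ℝ≥0) : tail 0 α = ∑' J, (α J : ℝ≥0∞) := by
  simp [tail]

theorem tail_succ (n : ℕ) (α : Dyadic → ℝ≥0) :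
    tail (n + 1) α = tail n (α ∘ ofLeft) + tail n (α ∘ ofRight) := by
  rw [tail, tsum_dyadic]
  simp [tail, root, ofLeft, ofRight]

theorem tail_le (n : ℕ) (α : Dyadic → ℝ≥0) : tail n α ≤ ∑' J, (α J : ℝ≥0∞) :=
  ENNReal.tsum_le_tsum fun J => by split_ifs <;> simp

theorem tendsto_tail (h : ∑' J, (α J : ℝ≥0∞) ≠ ∞) : Tendsto (fun n => tail n α) atTop (𝓝 0) := by
  have tail_eq (n : ℕ) : tail n α = ∑' i, ∑' k, (α ⟨i + n, k⟩ : ℝ≥0∞) := by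
    rw [tail, ENNReal.tsum_sigma' fun J : Dyadic => if n ≤ J.1 then (α J : ℝ≥0∞) else 0,
      ← ENNReal.summable.sum_add_tsum_nat_add' (k := n), Finset.sum_eq_zero, zero_add]
    · simp
    · intro i hi
      simp [Finset.mem_range.1 hi]
  simp_rw [tail_eq]
  rw [ENNReal.tsum_sigma'] at h
  exact ENNReal.tendsto_sum_nat_add (fun i => ∑' k, (α ⟨i, k⟩ : ℝ≥0∞)) h

theorem sum_mass_generation (hcd : c < d) (μ : Measure ℝ) (α : Dyadic → ℝ≥0) (n : ℕ) :
    ∑ k, mass c d μ α ⟨n, k⟩ = μ (Ico c d) + tail n α := by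
  induction n generalizing c d α with
  | zero => exact (Fin.sum_univ_one _).trans (tail_zero α ▸ mass_root hcd.le μ α)
  | succ n ih =>
    rw [sum_generation_succ]
    simp only [mass_ofLeft hcd, mass_ofRight hcd]
    rw [ih (left_lt_add_div_two.2 hcd), ih (add_div_two_lt_right.2 hcd), measure_Ico_half hcd,
      tail_succ]
    ring

theorem sum_setIntegral_interval (hcd : c < d) {f : ℝ → ℝ} (hf : IntegrableOn f (Ico c d) μ)
    (n : ℕ) : ∑ k, ∫ t in interval c d ⟨n, k⟩, f t ∂μ = ∫ t in Ico c d, f t ∂μ := by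
  rw [← iUnion_interval hcd n, integral_iUnion_fintype (fun _ => measurableSet_interval _ _ _)
    (pairwise_disjoint_interval c d n) fun _ => hf.mono_set (interval_subset_Ico hcd.le _)]

/-- The Carleson condition with constant `K` for the measure `μ` and the numbers `α`. -/
def IsCarleson (K : ℝ≥0) (c d : ℝ) (μ : Measure ℝ) (α : Dyadic → ℝ≥0) : Prop :=
  ∀ J, mass c d μ α J ≤ K * volume (interval c d J)

namespace IsCarleson

variable {K : ℝ≥0}

theorem mass_ne_top (h : IsCarleson K c d μ α) (J : Dyadic) : mass c d μ α J ≠ ∞ :=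
  ne_top_of_le_ne_top (ENNReal.mul_ne_top ENNReal.coe_ne_top measure_Ico_lt_top.ne) (h J)

theorem measure_Ico_ne_top (h : IsCarleson K c d μ α) (hcd : c < d) : μ (Ico c d) ≠ ∞ :=
  ne_top_of_le_ne_top (h.mass_ne_top root) (mass_root hcd.le μ α ▸ le_self_add)

theorem tsum_ne_top (h : IsCarleson K c d μ α) (hcd : c < d) : ∑' J, (α J : ℝ≥0∞) ≠ ∞ :=
  ne_top_of_le_ne_top (h.mass_ne_top root) (mass_root hcd.le μ α ▸ le_add_self)

theorem toReal_mass_le (h : IsCarleson K c d μ α) (J : Dyadic) :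
    (mass c d μ α J).toReal ≤ K * volume.real (interval c d J) :=
  (ENNReal.toReal_mono (ENNReal.mul_ne_top ENNReal.coe_ne_top measure_Ico_lt_top.ne)
    (h J)).trans_eq ENNReal.toReal_mul

theorem restrict_Ico_le (h : IsCarleson K c d μ α) (hcd : c < d) :
    μ.restrict (Ico c d) ≤ K • volume.restrict (Ico c d) := by
  rw [← Measure.restrict_smul]
  exact restrict_Ico_le_restrict hcd fun J => le_self_add.trans (h J)

theorem integrableOn (h : IsCarleson K c d μ α) (hcd : c < d) {f : ℝ → ℝ}
    (hf : IntegrableOn f (Ico c d)) : IntegrableOn f (Ico c d) μ :=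
  Integrable.of_measure_le_smul ENNReal.coe_ne_top (h.restrict_Ico_le hcd) hf

theorem abs_setIntegral_le (h : IsCarleson K c d μ α) (hcd : c < d) {f : ℝ → ℝ}
    (hf : IntegrableOn f (Ico c d)) : |∫ t in Ico c d, f t ∂μ| ≤ K * ∫ t in Ico c d, |f t| :=
  calc |∫ t in Ico c d, f t ∂μ| ≤ ∫ t in Ico c d, |f t| ∂μ := abs_integral_le_integral_abs
    _ ≤ ∫ t, |f t| ∂(K • volume.restrict (Ico c d)) :=
        integral_mono_measure (h.restrict_Ico_le hcd) (ae_of_all _ fun _ => abs_nonneg _)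
          hf.abs.smul_measure_nnreal
    _ = K * ∫ t in Ico c d, |f t| := integral_smul_nnreal_measure _ _

end IsCarleson

/-- The sum `∑ ⟨f⟩_J (μ(J) + ∑_{ℓ ∈ D(J)} α_ℓ)` over the dyadic intervals `J` of generation `n`:
what is left of an embedding sum for `f` after `n` steps of an induction on scales. -/
noncomputable def dyadicSum (c d : ℝ) (μ : Measure ℝ) (α : Dyadic → ℝ≥0) (f : ℝ → ℝ) (n : ℕ) : ℝ :=
  ∑ k, avg c d f ⟨n, k⟩ * (mass c d μ α ⟨n, k⟩).toReal

theorem dyadicSum_zero (c d : ℝ) (μ : Measure ℝ) (α : Dyadic → ℝ≥0) (f : ℝ → ℝ) :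
    dyadicSum c d μ α f 0 = (⨍ t in Ico c d, f t) * (mass c d μ α root).toReal := by
  rw [← avg_root]
  exact Fin.sum_univ_one _

theorem dyadicSum_succ (hcd : c < d) (μ : Measure ℝ) (α : Dyadic → ℝ≥0) (f : ℝ → ℝ) (n : ℕ) :
    dyadicSum c d μ α f (n + 1) = dyadicSum c ((c + d) / 2) μ (α ∘ ofLeft) f n +
      dyadicSum ((c + d) / 2) d μ (α ∘ ofRight) f n := by
  rw [dyadicSum, sum_generation_succ fun J => avg c d f J * (mass c d μ α J).toReal]
  simp only [dyadicSum, avg_ofLeft, avg_ofRight, mass_ofLeft hcd, mass_ofRight hcd]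

theorem dyadicSum_nonneg (c d : ℝ) (μ : Measure ℝ) (α : Dyadic → ℝ≥0) {f : ℝ → ℝ} (hf : 0 ≤ f)
    (n : ℕ) : 0 ≤ dyadicSum c d μ α f n := by
  refine Finset.sum_nonneg fun k _ => mul_nonneg ?_ ENNReal.toReal_nonneg
  rw [avg, setAverage_eq]
  exact smul_nonneg (inv_nonneg.2 measureReal_nonneg) (integral_nonneg hf)

theorem volume_real_interval_pos (hcd : c < d) (J : Dyadic) : 0 < volume.real (interval c d J) := by
  rw [Measure.real, volume_interval, ENNReal.toReal_ofReal (by have := sub_pos.2 hcd; positivity)]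
  exact div_pos (sub_pos.2 hcd) (by positivity)

theorem avg_sub (hcd : c < d) {f g : ℝ → ℝ} (hf : IntegrableOn f (Ico c d))
    (hg : IntegrableOn g (Ico c d)) (J : Dyadic) :
    avg c d (f - g) J = avg c d f J - avg c d g J := by
  simp only [avg, setAverage_eq, Pi.sub_apply, smul_eq_mul,
    integral_sub (hf.mono_set (interval_subset_Ico hcd.le J))
      (hg.mono_set (interval_subset_Ico hcd.le J)), mul_sub]

theorem dyadicSum_sub (hcd : c < d) {f g : ℝ → ℝ} (hf : IntegrableOn f (Ico c d))
    (hg : IntegrableOn g (Ico c d)) (n : ℕ) :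
    dyadicSum c d μ α (f - g) n = dyadicSum c d μ α f n - dyadicSum c d μ α g n := by
  simp only [dyadicSum, avg_sub hcd hf hg, sub_mul, Finset.sum_sub_distrib]

theorem abs_avg_mul_le (hcd : c < d) (f : ℝ → ℝ) (J : Dyadic) {x K : ℝ} (hx₀ : 0 ≤ x)
    (hx : x ≤ K * volume.real (interval c d J)) :
    |avg c d f J * x| ≤ K * ∫ t in interval c d J, |f t| := by
  have volume_pos := volume_real_interval_pos hcd J
  rw [avg, setAverage_eq, smul_eq_mul, abs_mul, abs_mul, abs_inv, abs_of_pos volume_pos,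
    abs_of_nonneg hx₀]
  calc (volume.real (interval c d J))⁻¹ * |∫ t in interval c d J, f t| * x
      ≤ (volume.real (interval c d J))⁻¹ * (∫ t in interval c d J, |f t|) *
          (K * volume.real (interval c d J)) := by
        gcongr
        exact abs_integral_le_integral_abs
    _ = K * ∫ t in interval c d J, |f t| := by field_simp

theorem IsCarleson.abs_dyadicSum_le {K : ℝ≥0} (h : IsCarleson K c d μ α) (hcd : c < d)
    {f : ℝ → ℝ} (hf : IntegrableOn f (Ico c d)) (n : ℕ) :
    |dyadicSum c d μ α f n| ≤ K * ∫ t in Ico c d, |f t| :=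
  calc |dyadicSum c d μ α f n|
      ≤ ∑ k, |avg c d f ⟨n, k⟩ * (mass c d μ α ⟨n, k⟩).toReal| := Finset.abs_sum_le_sum_abs _ _
    _ ≤ ∑ k, K * ∫ t in interval c d ⟨n, k⟩, |f t| := Finset.sum_le_sum fun k _ =>
        abs_avg_mul_le hcd f _ ENNReal.toReal_nonneg (h.toReal_mass_le _)
    _ = K * ∫ t in Ico c d, |f t| := by
        rw [← Finset.mul_sum, sum_setIntegral_interval hcd hf.abs]

theorem abs_avg_sub_le (hcd : c < d) {g : ℝ → ℝ} {J : Dyadic} {y ω : ℝ}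
    (hg : IntegrableOn g (Ico c d)) (hω : ∀ t ∈ interval c d J, |g t - y| ≤ ω) :
    |avg c d g J - y| ≤ ω := by
  have volume_ne_zero : volume (interval c d J) ≠ 0 := fun h =>
    (volume_real_interval_pos hcd J).ne' (by rw [Measure.real, h, ENNReal.toReal_zero])
  exact (convex_closedBall y ω).set_average_mem Metric.isClosed_closedBall volume_ne_zero
    measure_Ico_lt_top.ne (ae_restrict_of_forall_mem (measurableSet_interval c d J) hω)
    (hg.mono_set (interval_subset_Ico hcd.le J))

theorem IsCarleson.abs_avg_mul_mass_sub_setIntegral_le {K : ℝ≥0} (h : IsCarleson K c d μ α)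
    (hcd : c < d) {g : ℝ → ℝ} {J : Dyadic} {C ω : ℝ} (hg : IntegrableOn g (Ico c d))
    (hC : ∀ t, |g t| ≤ C)
    (hω : ∀ s ∈ interval c d J, ∀ t ∈ interval c d J, |g s - g t| ≤ ω) :
    |avg c d g J * (mass c d μ α J).toReal - ∫ t in interval c d J, g t ∂μ| ≤
      C * ((mass c d μ α J).toReal - μ.real (interval c d J)) +
        ω * μ.real (interval c d J) := by
  have measure_le_mass : μ (interval c d J) ≤ mass c d μ α J := le_self_add
  have measure_lt_top := measure_le_mass.trans_lt (h.mass_ne_top J).lt_top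
  have measure_real_le : μ.real (interval c d J) ≤ (mass c d μ α J).toReal :=
    ENNReal.toReal_mono (h.mass_ne_top J) measure_le_mass
  have abs_avg_le : |avg c d g J| ≤ C := by
    simpa using abs_avg_sub_le (y := 0) hcd hg fun t _ => by simpa using hC t
  have oscillation_le : ‖∫ t in interval c d J, (g t - avg c d g J) ∂μ‖ ≤
      ω * μ.real (interval c d J) := by
    refine norm_setIntegral_le_of_norm_le_const measure_lt_top fun t ht => ?_
    rw [Real.norm_eq_abs, abs_sub_comm]
    exact abs_avg_sub_le hcd hg fun s hs => hω s hs t ht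
  rw [integral_sub ((h.integrableOn hcd hg).mono_set (interval_subset_Ico hcd.le J))
    (integrableOn_const measure_lt_top.ne), setIntegral_const, smul_eq_mul, Real.norm_eq_abs,
    abs_sub_comm] at oscillation_le
  calc |avg c d g J * (mass c d μ α J).toReal - ∫ t in interval c d J, g t ∂μ|
      = |avg c d g J * ((mass c d μ α J).toReal - μ.real (interval c d J)) +
          (μ.real (interval c d J) * avg c d g J - ∫ t in interval c d J, g t ∂μ)| := by
        ring_nf
    _ ≤ _ := (abs_add_le _ _).trans (add_le_add ?_ oscillation_le)
  rw [abs_mul, abs_of_nonneg (sub_nonneg.2 measure_real_le)]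
  exact mul_le_mul_of_nonneg_right abs_avg_le (sub_nonneg.2 measure_real_le)

theorem IsCarleson.abs_dyadicSum_sub_setIntegral_le {K : ℝ≥0} (h : IsCarleson K c d μ α)
    (hcd : c < d) {g : ℝ → ℝ} {C ω : ℝ} (hg : IntegrableOn g (Ico c d)) (hC : ∀ t, |g t| ≤ C)
    (n : ℕ) (hω : ∀ k, ∀ s ∈ interval c d ⟨n, k⟩, ∀ t ∈ interval c d ⟨n, k⟩, |g s - g t| ≤ ω) :
    |dyadicSum c d μ α g n - ∫ t in Ico c d, g t ∂μ| ≤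
      C * (tail n α).toReal + ω * μ.real (Ico c d) := by
  have measure_ne_top := h.measure_Ico_ne_top hcd
  have sum_mass : ∑ k, (mass c d μ α ⟨n, k⟩).toReal = μ.real (Ico c d) + (tail n α).toReal := by
    rw [← ENNReal.toReal_sum fun _ _ => h.mass_ne_top _, sum_mass_generation hcd,
      ENNReal.toReal_add measure_ne_top (ne_top_of_le_ne_top (h.tsum_ne_top hcd) (tail_le n α)),
      Measure.real]
  have sum_measure : ∑ k, μ.real (interval c d ⟨n, k⟩) = μ.real (Ico c d) := by
    simpa using sum_setIntegral_interval hcd (integrableOn_const (C := (1 : ℝ)) measure_ne_top) n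
  rw [dyadicSum, ← sum_setIntegral_interval hcd (h.integrableOn hcd hg) n, ← Finset.sum_sub_distrib]
  calc |∑ k, (avg c d g ⟨n, k⟩ * (mass c d μ α ⟨n, k⟩).toReal -
          ∫ t in interval c d ⟨n, k⟩, g t ∂μ)|
      ≤ ∑ k, (C * ((mass c d μ α ⟨n, k⟩).toReal - μ.real (interval c d ⟨n, k⟩)) +
          ω * μ.real (interval c d ⟨n, k⟩)) :=
        (Finset.abs_sum_le_sum_abs _ _).trans <| Finset.sum_le_sum fun k _ =>
          h.abs_avg_mul_mass_sub_setIntegral_le hcd hg hC (hω k)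
    _ = C * (tail n α).toReal + ω * μ.real (Ico c d) := by
        rw [Finset.sum_add_distrib, ← Finset.mul_sum, ← Finset.mul_sum, Finset.sum_sub_distrib,
          sum_mass, sum_measure, add_sub_cancel_left]

theorem IsCarleson.tendsto_dyadicSum_of_hasCompactSupport {K : ℝ≥0} (h : IsCarleson K c d μ α)
    (hcd : c < d) {g : ℝ → ℝ} (hg : Continuous g) (hg' : HasCompactSupport g) :
    Tendsto (dyadicSum c d μ α g) atTop (𝓝 (∫ t in Ico c d, g t ∂μ)) := by
  obtain ⟨C, hC⟩ := hg'.exists_bound_of_continuous hg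
  have hgi : IntegrableOn g (Ico c d) := (hg.integrable_of_hasCompactSupport hg').integrableOn
  have tail_tendsto : Tendsto (fun n => C * (tail n α).toReal) atTop (𝓝 0) := by
    simpa using ((ENNReal.tendsto_toReal ENNReal.zero_ne_top).comp
      (tendsto_tail (h.tsum_ne_top hcd))).const_mul C
  refine Metric.tendsto_nhds.2 fun ε hε => ?_
  obtain ⟨δ, hδ, hgδ⟩ := Metric.uniformContinuous_iff.1 (hg'.uniformContinuous_of_continuous hg)
    (ε / 2 / (μ.real (Ico c d) + 1)) (by positivity)
  filter_upwards [tail_tendsto.eventually_lt_const (half_pos hε),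
    (tendsto_div_two_pow (d - c)).eventually_lt_const hδ] with n tail_lt length_lt
  have oscillation_le : ∀ k, ∀ s ∈ interval c d ⟨n, k⟩, ∀ t ∈ interval c d ⟨n, k⟩,
      |g s - g t| ≤ ε / 2 / (μ.real (Ico c d) + 1) := fun k s hs t ht =>
    (hgδ ((Metric.mem_ball.1 (interval_subset_ball ht hs)).trans length_lt)).le
  calc |dyadicSum c d μ α g n - ∫ t in Ico c d, g t ∂μ|
      ≤ C * (tail n α).toReal + ε / 2 / (μ.real (Ico c d) + 1) * μ.real (Ico c d) :=
        h.abs_dyadicSum_sub_setIntegral_le hcd hgi hC n oscillation_le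
    _ ≤ C * (tail n α).toReal + ε / 2 := by
        rw [div_mul_eq_mul_div, mul_div_assoc]
        gcongr
        exact mul_le_of_le_one_right (half_pos hε).le
          (div_le_one_of_le₀ (le_add_of_nonneg_right zero_le_one) (by positivity))
    _ < ε := by linarith

theorem IsCarleson.tendsto_dyadicSum {K : ℝ≥0} (h : IsCarleson K c d μ α) (hcd : c < d)
    {f : ℝ → ℝ} (hf : IntegrableOn f (Ico c d)) :
    Tendsto (dyadicSum c d μ α f) atTop (𝓝 (∫ t in Ico c d, f t ∂μ)) := by
  refine Metric.tendsto_nhds.2 fun ε hε => ?_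
  obtain ⟨g, hg', hfg, hg, hgi⟩ :=
    hf.exists_hasCompactSupport_integral_sub_le (ε := ε / 3 / (K + 1)) (by positivity)
  have approx_le : K * ∫ t in Ico c d, |(f - g) t| ≤ ε / 3 :=
    calc K * ∫ t in Ico c d, |(f - g) t| ≤ (K + 1) * (ε / 3 / (K + 1)) := by
          gcongr
          · exact le_add_of_nonneg_right zero_le_one
          · exact hfg
      _ = ε / 3 := mul_div_cancel₀ _ (by positivity)
  have integral_le := (h.abs_setIntegral_le hcd (hf.sub hgi)).trans approx_le
  simp only [Pi.sub_apply] at integral_le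
  rw [integral_sub (h.integrableOn hcd hf) (h.integrableOn hcd hgi)] at integral_le
  filter_upwards [Metric.tendsto_nhds.1 (h.tendsto_dyadicSum_of_hasCompactSupport hcd hg hg')
    (ε / 3) (by positivity)] with n hn
  have sum_le := (h.abs_dyadicSum_le hcd (hf.sub hgi) n).trans approx_le
  rw [dyadicSum_sub hcd hf hgi] at sum_le
  rw [Real.dist_eq] at hn ⊢
  rw [abs_le] at sum_le integral_le
  rw [abs_lt] at hn ⊢
  constructor <;> linarith

end

variable {m M : ℝ}

/-- The domain `Ω` of the lower Bellman function. -/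
def domain (m M : ℝ) : Set (ℝ × ℝ × ℝ) := {x | x.1 ^ 2 ≤ x.2.1 ∧ x.2.2 ∈ Icc m M}

theorem convex_domain (m M : ℝ) : Convex ℝ (domain m M) := by
  have sq_le : Convex ℝ {x : ℝ × ℝ | x.1 ^ 2 ≤ x.2} := by
    simpa using (even_two.convexOn_pow (𝕜 := ℝ)).convex_epigraph
  intro x hx y hy a b ha hb hab
  exact ⟨sq_le (x := (x.1, x.2.1)) (y := (y.1, y.2.1)) hx.1 hy.1 ha hb hab,
    convex_Icc m M hx.2 hy.2 ha hb hab⟩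

/-- Three properties of the lower Bellman function: convexity, the *jump inequality* describing a
number `α_I = a |I|` placed at the top interval, and the bound obtained from constant densities.
Every function with these properties lies below the lower Bellman function. -/
structure IsMinorant (m M : ℝ) (G : ℝ × ℝ × ℝ → ℝ) : Prop where
  convexOn : ConvexOn ℝ (domain m M) G
  jump_le : ∀ x₁ x₂ x₃ a : ℝ, (x₁, x₂, x₃) ∈ domain m M → 0 ≤ a → x₃ + a ≤ M →
    G (x₁, x₂, x₃ + a) ≤ G (x₁, x₂, x₃) + a * x₁ ^ 2
  le_mul : ∀ x ∈ domain m M, G x ≤ x.2.1 * x.2.2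

/-- Every dyadic subinterval `J` of `[c, d)` has mass between `m |J|` and `M |J|`. -/
def MassBounds (m M c d : ℝ) (μ : Measure ℝ) (α : Dyadic → ℝ≥0) : Prop :=
  ∀ J, ENNReal.ofReal m * volume (interval c d J) ≤ mass c d μ α J ∧
    mass c d μ α J ≤ ENNReal.ofReal M * volume (interval c d J)

/-- The point of `Ω` at which the test function `φ`, the measure `μ` and the numbers `α` on `[c, d)`
compete. -/
noncomputable def bellmanPoint (c d : ℝ) (φ : ℝ → ℝ) (μ : Measure ℝ) (α : Dyadic → ℝ≥0) :
    ℝ × ℝ × ℝ :=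
  (⨍ t in Ico c d, φ t, ⨍ t in Ico c d, φ t ^ 2, (mass c d μ α root).toReal / (d - c))

/-- The sum `∑ ⟨φ⟩_J² α_J` over the dyadic subintervals of `[c, d)`. -/
noncomputable def carlesonSum (c d : ℝ) (φ : ℝ → ℝ) (α : Dyadic → ℝ≥0) : ℝ≥0∞ :=
  ∑' J, ENNReal.ofReal (avg c d φ J ^ 2) * (α J : ℝ≥0∞)

/-! ### Minorants lie below the Bellman function -/

section

variable {c d : ℝ} {φ : ℝ → ℝ} {μ : Measure ℝ} {α : Dyadic → ℝ≥0}

theorem functional_eq (c d : ℝ) (φ : ℝ → ℝ) (μ : Measure ℝ) (α : Dyadic → ℝ≥0) :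
    functional c d φ μ α = (∫⁻ t in Ico c d, ENNReal.ofReal (φ t ^ 2) ∂μ + carlesonSum c d φ α) /
      ENNReal.ofReal (d - c) := by
  rw [functional, Real.volume_Ico, carlesonSum]

theorem carlesonSum_eq_add (c d : ℝ) (φ : ℝ → ℝ) (α : Dyadic → ℝ≥0) :
    carlesonSum c d φ α = ENNReal.ofReal ((⨍ t in Ico c d, φ t) ^ 2) * α root +
      (carlesonSum c ((c + d) / 2) φ (α ∘ ofLeft) +
        carlesonSum ((c + d) / 2) d φ (α ∘ ofRight)) := by
  rw [carlesonSum, tsum_dyadic]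
  simp only [avg_root, avg_ofLeft, avg_ofRight, carlesonSum, Function.comp]

theorem sq_average_le (hcd : c < d) (hφ : MemLp φ 2 (volume.restrict (Ico c d))) :
    (⨍ t in Ico c d, φ t) ^ 2 ≤ ⨍ t in Ico c d, φ t ^ 2 :=
  ((even_two.convexOn_pow (𝕜 := ℝ)).set_average_mem_epigraph (by fun_prop) isClosed_univ
    (by simp [hcd]) measure_Ico_lt_top.ne (by simp) (hφ.integrable one_le_two)
    hφ.integrable_sq).2

theorem MassBounds.left (h : MassBounds m M c d μ α) (hcd : c < d) :
    MassBounds m M c ((c + d) / 2) μ (α ∘ ofLeft) := fun J => by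
  simpa only [mass_ofLeft hcd, interval_ofLeft] using h (ofLeft J)

theorem MassBounds.right (h : MassBounds m M c d μ α) (hcd : c < d) :
    MassBounds m M ((c + d) / 2) d μ (α ∘ ofRight) := fun J => by
  simpa only [mass_ofRight hcd, interval_ofRight] using h (ofRight J)

theorem MassBounds.isCarleson (h : MassBounds m M c d μ α) : IsCarleson M.toNNReal c d μ α :=
  fun J => (h J).2

theorem MassBounds.bellmanPoint_mem (h : MassBounds m M c d μ α) (hcd : c < d) (hm : 0 ≤ m)
    (hM : 0 ≤ M) (hφ : MemLp φ 2 (volume.restrict (Ico c d))) :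
    bellmanPoint c d φ μ α ∈ domain m M := by
  have length_pos := sub_pos.2 hcd
  have le_mass := (h root).1
  have mass_le := (h root).2
  rw [interval_root, Real.volume_Ico, ← ENNReal.ofReal_mul ‹_›] at le_mass mass_le
  refine ⟨sq_average_le hcd hφ, (le_div_iff₀ length_pos).2 ?_, (div_le_iff₀ length_pos).2 ?_⟩
  · exact (ENNReal.ofReal_le_iff_le_toReal (h.isCarleson.mass_ne_top root)).1 le_mass
  · exact ENNReal.toReal_le_of_le_ofReal (by positivity) mass_le

theorem bellmanPoint_eq (h : MassBounds m M c d μ α) (hcd : c < d)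
    (hφ : MemLp φ 2 (volume.restrict (Ico c d))) {p q : ℝ × ℝ × ℝ}
    (hp : bellmanPoint c ((c + d) / 2) φ μ (α ∘ ofLeft) = p)
    (hq : bellmanPoint ((c + d) / 2) d φ μ (α ∘ ofRight) = q) :
    bellmanPoint c d φ μ α =
      ((p.1 + q.1) / 2, (p.2.1 + q.2.1) / 2, (p.2.2 + q.2.2) / 2 + α root / (d - c)) := by
  subst hp hq
  have length_ne : d - c ≠ 0 := (sub_pos.2 hcd).ne'
  have length_left : (c + d) / 2 - c = (d - c) / 2 := by ring
  have length_right : d - (c + d) / 2 = (d - c) / 2 := by ring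
  have left_ne_top := (h.left hcd).isCarleson.mass_ne_top root
  have right_ne_top := (h.right hcd).isCarleson.mass_ne_top root
  simp only [bellmanPoint]
  rw [average_half hcd (hφ.integrable one_le_two), average_half hcd hφ.integrable_sq,
    mass_root_eq_add hcd, ENNReal.toReal_add ENNReal.coe_ne_top
      (ENNReal.add_ne_top.2 ⟨left_ne_top, right_ne_top⟩),
    ENNReal.toReal_add left_ne_top right_ne_top, length_left, length_right, ENNReal.coe_toReal]
  congr 2
  field_simp
  ring

theorem Admissible.massBounds {x₁ x₂ x₃ : ℝ} (h : Admissible c d m M x₁ x₂ x₃ φ μ α) :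
    MassBounds m M c d μ α := fun J => ⟨h.le_mass J, h.mass_le J⟩

theorem Admissible.bellmanPoint_eq {x₁ x₂ x₃ : ℝ} (h : Admissible c d m M x₁ x₂ x₃ φ μ α)
    (hcd : c < d) (hx₃ : 0 ≤ x₃) : bellmanPoint c d φ μ α = (x₁, x₂, x₃) := by
  have mass_eq := congr_arg ENNReal.toReal h.mass_eq
  rw [← mass_root hcd.le, Real.volume_Ico, ENNReal.toReal_div,
    ENNReal.toReal_ofReal (sub_pos.2 hcd).le, ENNReal.toReal_ofReal hx₃] at mass_eq
  rw [bellmanPoint, h.avg_eq, h.avg_sq_eq, mass_eq]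

namespace IsMinorant

variable {G : ℝ × ℝ × ℝ → ℝ}

theorem midpoint_jump_le (hG : IsMinorant m M G) {p q : ℝ × ℝ × ℝ} (hp : p ∈ domain m M)
    (hq : q ∈ domain m M) {a : ℝ} (ha : 0 ≤ a) (hM : (p.2.2 + q.2.2) / 2 + a ≤ M) :
    G ((p.1 + q.1) / 2, (p.2.1 + q.2.1) / 2, (p.2.2 + q.2.2) / 2 + a) ≤
      (G p + G q) / 2 + a * ((p.1 + q.1) / 2) ^ 2 := by
  have midpoint_eq : (2⁻¹ : ℝ) • p + (2⁻¹ : ℝ) • q =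
      ((p.1 + q.1) / 2, (p.2.1 + q.2.1) / 2, (p.2.2 + q.2.2) / 2) := by
    ext <;> simp <;> ring
  have midpoint_mem := convex_domain m M hp hq (by norm_num : (0 : ℝ) ≤ 2⁻¹)
    (by norm_num : (0 : ℝ) ≤ 2⁻¹) (by norm_num)
  have convex_le := hG.convexOn.2 hp hq (by norm_num : (0 : ℝ) ≤ 2⁻¹)
    (by norm_num : (0 : ℝ) ≤ 2⁻¹) (by norm_num)
  rw [midpoint_eq] at midpoint_mem convex_le
  simp only [smul_eq_mul] at convex_le
  linarith [hG.jump_le _ _ _ a midpoint_mem ha hM]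

theorem length_mul_bellmanPoint_le (hG : IsMinorant m M G) (hm : 0 ≤ m) (hM : 0 ≤ M)
    (h : MassBounds m M c d μ α) (hcd : c < d) (hφ : MemLp φ 2 (volume.restrict (Ico c d))) :
    (d - c) * G (bellmanPoint c d φ μ α) ≤ (⨍ t in Ico c d, φ t) ^ 2 * α root +
      ((((c + d) / 2) - c) * G (bellmanPoint c ((c + d) / 2) φ μ (α ∘ ofLeft)) +
        (d - (c + d) / 2) * G (bellmanPoint ((c + d) / 2) d φ μ (α ∘ ofRight))) := by
  have length_pos := sub_pos.2 hcd
  have left_lt := left_lt_add_div_two.2 hcd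
  have lt_right := add_div_two_lt_right.2 hcd
  have left_mem := (h.left hcd).bellmanPoint_mem left_lt hm hM
    (hφ.mono_measure (Measure.restrict_mono_set _ (Ico_subset_Ico_right lt_right.le)))
  have right_mem := (h.right hcd).bellmanPoint_mem lt_right hm hM
    (hφ.mono_measure (Measure.restrict_mono_set _ (Ico_subset_Ico_left left_lt.le)))
  have point_eq := bellmanPoint_eq h hcd hφ rfl rfl
  have main := hG.midpoint_jump_le left_mem right_mem (a := α root / (d - c)) (by positivity)
    (point_eq ▸ h.bellmanPoint_mem hcd hm hM hφ).2.2
  have average_eq : ⨍ t in Ico c d, φ t = ((bellmanPoint c ((c + d) / 2) φ μ (α ∘ ofLeft)).1 +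
      (bellmanPoint ((c + d) / 2) d φ μ (α ∘ ofRight)).1) / 2 := congr_arg Prod.fst point_eq
  rw [← point_eq, ← average_eq] at main
  refine (mul_le_mul_of_nonneg_left main length_pos.le).trans_eq ?_
  field_simp
  ring

theorem ofReal_length_mul_bellmanPoint_le (hG : IsMinorant m M G) (hm : 0 ≤ m) (hM : 0 ≤ M)
    (h : MassBounds m M c d μ α) (hcd : c < d) (hφ : MemLp φ 2 (volume.restrict (Ico c d)))
    (n : ℕ) :
    ENNReal.ofReal ((d - c) * G (bellmanPoint c d φ μ α)) ≤
      carlesonSum c d φ α + ENNReal.ofReal (dyadicSum c d μ α (fun t => φ t ^ 2) n) := by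
  induction n generalizing c d α with
  | zero =>
    refine (ENNReal.ofReal_le_ofReal ?_).trans le_add_self
    rw [dyadicSum_zero]
    calc (d - c) * G (bellmanPoint c d φ μ α)
        ≤ (d - c) * ((⨍ t in Ico c d, φ t ^ 2) * ((mass c d μ α root).toReal / (d - c))) :=
          mul_le_mul_of_nonneg_left (hG.le_mul _ (h.bellmanPoint_mem hcd hm hM hφ))
            (sub_nonneg.2 hcd.le)
      _ = (⨍ t in Ico c d, φ t ^ 2) * (mass c d μ α root).toReal := by
          have := (sub_pos.2 hcd).ne'
          field_simp
  | succ n ih =>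
    have left_lt := left_lt_add_div_two.2 hcd
    have lt_right := add_div_two_lt_right.2 hcd
    have left_le := ih (h.left hcd) left_lt
      (hφ.mono_measure (Measure.restrict_mono_set _ (Ico_subset_Ico_right lt_right.le)))
    have right_le := ih (h.right hcd) lt_right
      (hφ.mono_measure (Measure.restrict_mono_set _ (Ico_subset_Ico_left left_lt.le)))
    rw [dyadicSum_succ hcd, carlesonSum_eq_add,
      ENNReal.ofReal_add (dyadicSum_nonneg _ _ _ _ (fun t => sq_nonneg (φ t)) n)
        (dyadicSum_nonneg _ _ _ _ (fun t => sq_nonneg (φ t)) n)]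
    refine (ENNReal.ofReal_le_ofReal
      (hG.length_mul_bellmanPoint_le hm hM h hcd hφ)).trans ?_
    refine ENNReal.ofReal_add_le.trans <| (add_le_add_right (ENNReal.ofReal_add_le.trans
      (add_le_add left_le right_le)) _).trans_eq ?_
    rw [ENNReal.ofReal_mul (sq_nonneg _), ENNReal.ofReal_coe_nnreal]
    ring

theorem ofReal_le_Bmin (hG : IsMinorant m M G) (hm : 0 ≤ m) (hcd : c < d) {x₁ x₂ x₃ : ℝ}
    (hx : (x₁, x₂, x₃) ∈ domain m M) :
    ENNReal.ofReal (G (x₁, x₂, x₃)) ≤ Bmin c d m M x₁ x₂ x₃ := by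
  have x₃_nonneg : 0 ≤ x₃ := hm.trans hx.2.1
  refine le_iInf fun φ => le_iInf fun μ => le_iInf fun α => le_iInf fun hadm => ?_
  have carleson := hadm.massBounds.isCarleson
  have sq_integrable : IntegrableOn (fun t => φ t ^ 2) (Ico c d) := hadm.memLp.integrable_sq
  have sum_tendsto := (ENNReal.tendsto_ofReal
    (carleson.tendsto_dyadicSum hcd sq_integrable)).const_add (carlesonSum c d φ α)
  rw [ofReal_integral_eq_lintegral_ofReal (carleson.integrableOn hcd sq_integrable)
    (ae_of_all _ fun t => sq_nonneg (φ t))] at sum_tendsto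
  rw [functional_eq, ENNReal.le_div_iff_mul_le (by simp [hcd]) (by simp), mul_comm,
    ← ENNReal.ofReal_mul (sub_pos.2 hcd).le, ← hadm.bellmanPoint_eq hcd x₃_nonneg, add_comm]
  exact ge_of_tendsto' sum_tendsto (hG.ofReal_length_mul_bellmanPoint_le hm
    (x₃_nonneg.trans hx.2.2) hadm.massBounds hcd hadm.memLp)

end IsMinorant

end

section

variable {c d x₁ x₂ x₃ : ℝ} {φ ψ : ℝ → ℝ} {μ ν : Measure ℝ} {α : Dyadic → ℝ≥0}

/-! ### Concatenation of competitors on the two halves -/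

theorem mass_root_div_volume_eq_iff (hcd : c < d) {y : ℝ} :
    (μ (Ico c d) + ∑' J, (α J : ℝ≥0∞)) / volume (Ico c d) = ENNReal.ofReal y ↔
      mass c d μ α root = ENNReal.ofReal (y * (d - c)) := by
  rw [mass_root hcd.le, Real.volume_Ico, ENNReal.ofReal_mul' (sub_pos.2 hcd).le, eq_comm,
    ENNReal.eq_div_iff (by simp [hcd]) (by simp), mul_comm, eq_comm]

theorem memLp_two_restrict_Ico_of_half (hcd : c < d)
    (hl : MemLp φ 2 (volume.restrict (Ico c ((c + d) / 2))))
    (hr : MemLp φ 2 (volume.restrict (Ico ((c + d) / 2) d))) :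
    MemLp φ 2 (volume.restrict (Ico c d)) := by
  have measurable : AEStronglyMeasurable φ (volume.restrict (Ico c d)) := by
    rw [← Ico_union_half hcd, aestronglyMeasurable_union_iff]
    exact ⟨hl.1, hr.1⟩
  rw [memLp_two_iff_integrable_sq measurable, ← IntegrableOn, ← Ico_union_half hcd]
  exact IntegrableOn.union hl.integrable_sq hr.integrable_sq

theorem MassBounds.of_half (hcd : c < d)
    (hroot : ENNReal.ofReal m * volume (Ico c d) ≤ mass c d μ α root ∧
      mass c d μ α root ≤ ENNReal.ofReal M * volume (Ico c d))
    (hl : MassBounds m M c ((c + d) / 2) μ (α ∘ ofLeft))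
    (hr : MassBounds m M ((c + d) / 2) d μ (α ∘ ofRight)) : MassBounds m M c d μ α := fun J => by
  rcases eq_root_or_exists_eq_ofLeft_or_ofRight J with rfl | ⟨K, rfl⟩ | ⟨K, rfl⟩
  · rwa [interval_root]
  · rw [mass_ofLeft hcd, interval_ofLeft]
    exact hl K
  · rw [mass_ofRight hcd, interval_ofRight]
    exact hr K

theorem Admissible.of_half (hcd : c < d) (hm : 0 ≤ m) {p₁ p₂ p₃ q₁ q₂ q₃ a : ℝ} (hp₃ : m ≤ p₃)
    (hq₃ : m ≤ q₃) (ha : 0 ≤ a) (hM : (p₃ + q₃) / 2 + a ≤ M)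
    (hl : Admissible c ((c + d) / 2) m M p₁ p₂ p₃ φ μ (α ∘ ofLeft))
    (hr : Admissible ((c + d) / 2) d m M q₁ q₂ q₃ φ μ (α ∘ ofRight))
    (hroot : (α root : ℝ≥0∞) = ENNReal.ofReal (a * (d - c))) :
    Admissible c d m M ((p₁ + q₁) / 2) ((p₂ + q₂) / 2) ((p₃ + q₃) / 2 + a) φ μ α := by
  have : 0 < d - c := sub_pos.2 hcd
  have length_left : (c + d) / 2 - c = (d - c) / 2 := by ring
  have length_right : d - (c + d) / 2 = (d - c) / 2 := by ring
  have left_lt := left_lt_add_div_two.2 hcd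
  have lt_right := add_div_two_lt_right.2 hcd
  have p₃_nonneg := hm.trans hp₃
  have q₃_nonneg := hm.trans hq₃
  have memLp := memLp_two_restrict_Ico_of_half hcd hl.memLp hr.memLp
  have mass_eq : mass c d μ α root = ENNReal.ofReal (((p₃ + q₃) / 2 + a) * (d - c)) := by
    rw [mass_root_eq_add hcd, (mass_root_div_volume_eq_iff left_lt).1 hl.mass_eq,
      (mass_root_div_volume_eq_iff lt_right).1 hr.mass_eq, hroot, length_left, length_right,
      ← ENNReal.ofReal_add (by positivity) (by positivity),
      ← ENNReal.ofReal_add (by positivity) (by positivity)]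
    congr 1
    ring
  have bounds : MassBounds m M c d μ α := by
    refine .of_half hcd ?_ hl.massBounds hr.massBounds
    rw [mass_eq, Real.volume_Ico, ENNReal.ofReal_mul (by positivity)]
    constructor <;> gcongr
    linarith
  exact
    { memLp
      noAtoms := hl.noAtoms
      avg_eq := by rw [average_half hcd (memLp.integrable one_le_two), hl.avg_eq, hr.avg_eq]
      avg_sq_eq := by rw [average_half hcd memLp.integrable_sq, hl.avg_sq_eq, hr.avg_sq_eq]
      mass_eq := (mass_root_div_volume_eq_iff hcd).2 mass_eq
      le_mass := fun J => (bounds J).1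
      mass_le := fun J => (bounds J).2 }

theorem functional_eq_add (hcd : c < d) (φ : ℝ → ℝ) (μ : Measure ℝ) (α : Dyadic → ℝ≥0) :
    functional c d φ μ α = (functional c ((c + d) / 2) φ μ (α ∘ ofLeft) +
      functional ((c + d) / 2) d φ μ (α ∘ ofRight)) / 2 +
        ENNReal.ofReal ((⨍ t in Ico c d, φ t) ^ 2) * α root / volume (Ico c d) := by
  have volume_eq : ENNReal.ofReal (d - c) = ENNReal.ofReal ((d - c) / 2) * 2 := by
    rw [← ENNReal.ofReal_ofNat, ← ENNReal.ofReal_mul (by linarith), div_mul_cancel₀ _ two_ne_zero]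
  have length_left : (c + d) / 2 - c = (d - c) / 2 := by ring
  have length_right : d - (c + d) / 2 = (d - c) / 2 := by ring
  rw [functional_eq, functional_eq, functional_eq, carlesonSum_eq_add, ← Ico_union_half hcd,
    lintegral_union measurableSet_Ico Ico_disjoint_Ico_same, Ico_union_half hcd, Real.volume_Ico,
    length_left, length_right, ENNReal.div_add_div_same, div_eq_mul_inv _ (2 : ℝ≥0∞),
    div_eq_mul_inv _ (ENNReal.ofReal ((d - c) / 2)), mul_assoc, ← ENNReal.mul_inv (by simp)
    (by simp), ← volume_eq, ← div_eq_mul_inv, ENNReal.div_add_div_same]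
  congr 1
  ring

theorem avg_congr (hcd : c ≤ d) (h : EqOn φ ψ (Ico c d)) (J : Dyadic) :
    avg c d φ J = avg c d ψ J :=
  setAverage_congr_fun (measurableSet_interval c d J)
    (ae_of_all _ fun _ ht => h (interval_subset_Ico hcd J ht))

theorem mass_congr (hcd : c ≤ d) (h : μ.restrict (Ico c d) = ν.restrict (Ico c d))
    (α : Dyadic → ℝ≥0) (J : Dyadic) : mass c d μ α J = mass c d ν α J := by
  rw [mass, mass, ← Measure.restrict_eq_self μ (interval_subset_Ico hcd J), h,
    Measure.restrict_eq_self ν (interval_subset_Ico hcd J)]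

theorem functional_congr (hcd : c ≤ d) (hφ : EqOn φ ψ (Ico c d))
    (hμ : μ.restrict (Ico c d) = ν.restrict (Ico c d)) (α : Dyadic → ℝ≥0) :
    functional c d φ μ α = functional c d ψ ν α := by
  rw [functional, functional, hμ, tsum_congr fun J => by rw [avg_congr hcd hφ J],
    setLIntegral_congr_fun measurableSet_Ico fun t ht => by rw [hφ ht]]

theorem Admissible.congr (h : Admissible c d m M x₁ x₂ x₃ φ μ α) (hcd : c < d)
    (hν : ∀ t : ℝ, ν {t} = 0) (hφ : EqOn φ ψ (Ico c d))
    (hμ : μ.restrict (Ico c d) = ν.restrict (Ico c d)) : Admissible c d m M x₁ x₂ x₃ ψ ν α where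
  memLp := h.memLp.ae_eq ((ae_restrict_iff' measurableSet_Ico).2 (ae_of_all _ hφ))
  noAtoms := hν
  avg_eq := by
    rw [← h.avg_eq]
    exact setAverage_congr_fun measurableSet_Ico (ae_of_all _ hφ.symm)
  avg_sq_eq := by
    rw [← h.avg_sq_eq]
    exact setAverage_congr_fun measurableSet_Ico (ae_of_all _ fun t ht => by rw [hφ ht])
  mass_eq := by
    rw [mass_root_div_volume_eq_iff hcd, ← mass_congr hcd.le hμ, ← mass_root_div_volume_eq_iff hcd,
      h.mass_eq]
  le_mass J := mass_congr hcd.le hμ α J ▸ h.le_mass J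
  mass_le J := mass_congr hcd.le hμ α J ▸ h.mass_le J

/-- The family on `[c, d)` with value `a` at the top interval which restricts to `α` and `β` on the
two halves. -/
def glue (a : ℝ≥0) (α β : Dyadic → ℝ≥0) : Dyadic → ℝ≥0
  | ⟨0, _⟩ => a
  | ⟨n + 1, k⟩ =>
    if h : (k : ℕ) < 2 ^ n then α ⟨n, ⟨k, h⟩⟩
    else β ⟨n, ⟨k - 2 ^ n, by have := k.2; have := pow_succ 2 n; omega⟩⟩

theorem glue_root (a : ℝ≥0) (α β : Dyadic → ℝ≥0) : glue a α β root = a := rfl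

theorem glue_comp_ofLeft (a : ℝ≥0) (α β : Dyadic → ℝ≥0) : glue a α β ∘ ofLeft = α := by
  ext J
  simp [glue, ofLeft]

theorem glue_comp_ofRight (a : ℝ≥0) (α β : Dyadic → ℝ≥0) : glue a α β ∘ ofRight = β := by
  ext J
  simp [glue, ofRight]

theorem exists_common_extension (c d : ℝ) (φ ψ : ℝ → ℝ) (hμ : ∀ t : ℝ, μ {t} = 0)
    (hν : ∀ t : ℝ, ν {t} = 0) : ∃ (χ : ℝ → ℝ) (ρ : Measure ℝ), (∀ t : ℝ, ρ {t} = 0) ∧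
      EqOn φ χ (Ico c ((c + d) / 2)) ∧ EqOn ψ χ (Ico ((c + d) / 2) d) ∧
      μ.restrict (Ico c ((c + d) / 2)) = ρ.restrict (Ico c ((c + d) / 2)) ∧
      ν.restrict (Ico ((c + d) / 2) d) = ρ.restrict (Ico ((c + d) / 2) d) := by
  classical
  have inter_eq : Ico c ((c + d) / 2) ∩ Ico ((c + d) / 2) d = ∅ :=
    Ico_disjoint_Ico_same.inter_eq
  refine ⟨(Iio ((c + d) / 2)).piecewise φ ψ,
    μ.restrict (Ico c ((c + d) / 2)) + ν.restrict (Ico ((c + d) / 2) d), fun t => ?_,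
    fun t ht => (piecewise_eq_of_mem (Iio ((c + d) / 2)) _ _ ht.2).symm,
    fun t ht => (piecewise_eq_of_notMem (Iio ((c + d) / 2)) _ _ (not_lt.2 ht.1)).symm, ?_, ?_⟩
  · rw [Measure.add_apply, Measure.restrict_le_self.absolutelyContinuous (hμ t),
      Measure.restrict_le_self.absolutelyContinuous (hν t), add_zero]
  · simp [Measure.restrict_restrict, inter_eq]
  · simp [Measure.restrict_restrict, inter_comm _ (Ico c _), inter_eq]

theorem Bmin_le_functional (h : Admissible c d m M x₁ x₂ x₃ φ μ α) :
    Bmin c d m M x₁ x₂ x₃ ≤ functional c d φ μ α :=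
  iInf_le_of_le φ <| iInf_le_of_le μ <| iInf_le_of_le α <| iInf_le _ h

end

/-! ### Properties of the Bellman function -/

section

variable {c d x₁ x₂ x₃ : ℝ}

theorem Bmin_midpoint_add_le_functional (hcd : c < d) (hm : 0 ≤ m) {p₁ p₂ p₃ q₁ q₂ q₃ a : ℝ}
    (hp₃ : m ≤ p₃) (hq₃ : m ≤ q₃) (ha : 0 ≤ a) (hM : (p₃ + q₃) / 2 + a ≤ M)
    {φ ψ : ℝ → ℝ} {μ ν : Measure ℝ} {α β : Dyadic → ℝ≥0}
    (hl : Admissible c ((c + d) / 2) m M p₁ p₂ p₃ φ μ α)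
    (hr : Admissible ((c + d) / 2) d m M q₁ q₂ q₃ ψ ν β) :
    Bmin c d m M ((p₁ + q₁) / 2) ((p₂ + q₂) / 2) ((p₃ + q₃) / 2 + a) ≤
      (functional c ((c + d) / 2) φ μ α + functional ((c + d) / 2) d ψ ν β) / 2 +
        ENNReal.ofReal (a * ((p₁ + q₁) / 2) ^ 2) := by
  have length_pos : 0 < d - c := sub_pos.2 hcd
  have left_lt := left_lt_add_div_two.2 hcd
  have lt_right := add_div_two_lt_right.2 hcd
  obtain ⟨χ, ρ, hρ, hφ, hψ, hμ, hν⟩ := exists_common_extension c d φ ψ hl.noAtoms hr.noAtoms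
  set γ := glue (a * (d - c)).toNNReal α β with γ_def
  have γ_left : γ ∘ ofLeft = α := glue_comp_ofLeft _ _ _
  have γ_right : γ ∘ ofRight = β := glue_comp_ofRight _ _ _
  have γ_root : (γ root : ℝ≥0∞) = ENNReal.ofReal (a * (d - c)) := by
    rw [γ_def, glue_root]; rfl
  have hadm : Admissible c d m M _ _ _ χ ρ γ := .of_half hcd hm hp₃ hq₃ ha hM
    (by rw [γ_left]; exact hl.congr left_lt hρ hφ hμ)
    (by rw [γ_right]; exact hr.congr lt_right hρ hψ hν) γ_root
  refine (Bmin_le_functional hadm).trans_eq ?_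
  rw [functional_eq_add hcd, γ_left, γ_right, γ_root, hadm.avg_eq,
    functional_congr left_lt.le hφ hμ, functional_congr lt_right.le hψ hν,
    ← ENNReal.ofReal_mul (sq_nonneg _), Real.volume_Ico, ← ENNReal.ofReal_div_of_pos length_pos]
  congr 2
  field_simp

theorem Bmin_midpoint_add_le (hcd : c < d) (hm : 0 ≤ m) {p₁ p₂ p₃ q₁ q₂ q₃ a : ℝ}
    (hp₃ : m ≤ p₃) (hq₃ : m ≤ q₃) (ha : 0 ≤ a) (hM : (p₃ + q₃) / 2 + a ≤ M) :
    Bmin c d m M ((p₁ + q₁) / 2) ((p₂ + q₂) / 2) ((p₃ + q₃) / 2 + a) ≤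
      (Bmin c ((c + d) / 2) m M p₁ p₂ p₃ + Bmin ((c + d) / 2) d m M q₁ q₂ q₃) / 2 +
        ENNReal.ofReal (a * ((p₁ + q₁) / 2) ^ 2) := by
  rw [← tsub_le_iff_right, ENNReal.le_div_iff_mul_le (by simp) (by simp), ← tsub_le_iff_right]
  refine le_iInf fun φ => le_iInf fun μ => le_iInf fun α => le_iInf fun hl => ?_
  rw [tsub_le_iff_tsub_le]
  refine le_iInf fun ψ => le_iInf fun ν => le_iInf fun β => le_iInf fun hr => ?_
  rw [tsub_le_iff_left, ← ENNReal.le_div_iff_mul_le (by simp) (by simp), tsub_le_iff_right]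
  exact Bmin_midpoint_add_le_functional hcd hm hp₃ hq₃ ha hM hl hr

theorem Admissible.const_mul {φ : ℝ → ℝ} {μ : Measure ℝ} {α : Dyadic → ℝ≥0}
    (h : Admissible c d m M x₁ x₂ x₃ φ μ α) (k : ℝ) :
    Admissible c d m M (k * x₁) (k ^ 2 * x₂) x₃ (fun t => k * φ t) μ α where
  memLp := h.memLp.const_mul k
  noAtoms := h.noAtoms
  avg_eq := by rw [← h.avg_eq]; exact integral_const_mul _ _
  avg_sq_eq := by simp_rw [mul_pow, ← h.avg_sq_eq]; exact integral_const_mul _ _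
  mass_eq := h.mass_eq
  le_mass := h.le_mass
  mass_le := h.mass_le

theorem functional_const_mul (c d : ℝ) (φ : ℝ → ℝ) (μ : Measure ℝ) (α : Dyadic → ℝ≥0) (k : ℝ) :
    functional c d (fun t => k * φ t) μ α = ENNReal.ofReal (k ^ 2) * functional c d φ μ α := by
  have avg_mul (J : Dyadic) : avg c d (fun t => k * φ t) J = k * avg c d φ J :=
    integral_const_mul _ _
  simp_rw [functional, avg_mul, mul_pow, ENNReal.ofReal_mul (sq_nonneg k), mul_assoc]
  rw [lintegral_const_mul' _ _ ENNReal.ofReal_ne_top, ENNReal.tsum_mul_left, ← mul_add,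
    mul_div_assoc]

theorem Bmin_const_mul_le {k : ℝ} (hk : k ≠ 0) :
    Bmin c d m M (k * x₁) (k ^ 2 * x₂) x₃ ≤ ENNReal.ofReal (k ^ 2) * Bmin c d m M x₁ x₂ x₃ := by
  have sq_ne_zero : ENNReal.ofReal (k ^ 2) ≠ 0 := by simp [hk]
  simp only [Bmin, ENNReal.mul_iInf_of_ne sq_ne_zero ENNReal.ofReal_ne_top]
  refine le_iInf fun φ => le_iInf fun μ => le_iInf fun α => le_iInf fun hadm => ?_
  rw [← functional_const_mul]
  exact Bmin_le_functional (hadm.const_mul k)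

theorem Bmin_const_le (hcd : c < d) (v : ℝ) (hx₃ : x₃ ∈ Icc m M) :
    Bmin c d m M v (v ^ 2) x₃ ≤ ENNReal.ofReal (v ^ 2 * x₃) := by
  have volume_ne_zero : volume (Ico c d) ≠ 0 := by simp [hcd]
  have volume_ne_top : volume (Ico c d) ≠ ∞ := measure_Ico_lt_top.ne
  have mass_eq (J : Dyadic) : mass c d (ENNReal.ofReal x₃ • volume) 0 J =
      ENNReal.ofReal x₃ * volume (interval c d J) := by simp [mass]
  have hadm : Admissible c d m M v (v ^ 2) x₃ (fun _ => v) (ENNReal.ofReal x₃ • volume) 0 :=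
    { memLp := memLp_const v
      noAtoms := fun t => by simp
      avg_eq := setAverage_const volume_ne_zero volume_ne_top v
      avg_sq_eq := setAverage_const volume_ne_zero volume_ne_top (v ^ 2)
      mass_eq := by simp [ENNReal.mul_div_cancel_right, hcd]
      le_mass := fun J => by rw [mass_eq]; gcongr; exact hx₃.1
      mass_le := fun J => by rw [mass_eq]; gcongr; exact hx₃.2 }
  refine (Bmin_le_functional hadm).trans_eq ?_
  rw [ENNReal.ofReal_mul (sq_nonneg v)]
  simp [functional, ← mul_assoc, ENNReal.mul_div_cancel_right, hcd]

theorem Bmin_le_ofReal_mul (hcd : c < d) (hm : 0 ≤ m) (hx : (x₁, x₂, x₃) ∈ domain m M) :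
    Bmin c d m M x₁ x₂ x₃ ≤ ENNReal.ofReal (x₂ * x₃) := by
  have x₃_nonneg : 0 ≤ x₃ := hm.trans hx.2.1
  set σ := √(x₂ - x₁ ^ 2)
  have sq_σ : σ ^ 2 = x₂ - x₁ ^ 2 := Real.sq_sqrt (sub_nonneg.2 hx.1)
  have midpoint_eq₁ : ((x₁ - σ) + (x₁ + σ)) / 2 = x₁ := by ring
  have midpoint_eq₂ : ((x₁ - σ) ^ 2 + (x₁ + σ) ^ 2) / 2 = x₂ := by linear_combination sq_σ
  have midpoint_eq₃ : (x₃ + x₃) / 2 + 0 = x₃ := by ring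
  have main := Bmin_midpoint_add_le hcd hm (p₁ := x₁ - σ) (q₁ := x₁ + σ) (p₂ := (x₁ - σ) ^ 2)
    (q₂ := (x₁ + σ) ^ 2) hx.2.1 hx.2.1 le_rfl (midpoint_eq₃.trans_le hx.2.2)
  rw [midpoint_eq₁, midpoint_eq₂, midpoint_eq₃, zero_mul, ENNReal.ofReal_zero, add_zero] at main
  calc Bmin c d m M x₁ x₂ x₃
      ≤ (ENNReal.ofReal ((x₁ - σ) ^ 2 * x₃) + ENNReal.ofReal ((x₁ + σ) ^ 2 * x₃)) / 2 := by
        refine main.trans ?_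
        gcongr
        · exact Bmin_const_le (left_lt_add_div_two.2 hcd) _ hx.2
        · exact Bmin_const_le (add_div_two_lt_right.2 hcd) _ hx.2
    _ = ENNReal.ofReal (x₂ * x₃) := by
        rw [← ENNReal.ofReal_add (by positivity) (by positivity), ← ENNReal.ofReal_ofNat,
          ← ENNReal.ofReal_div_of_pos two_pos]
        congr 1
        linear_combination x₃ * midpoint_eq₂

end

/-! ### Convexity from midpoint convexity -/

theorem nonpos_of_midpoint_le {g : ℝ → ℝ} (bdd : BddAbove (g '' Icc 0 1)) (zero_le : g 0 ≤ 0)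
    (one_le : g 1 ≤ 0)
    (midpoint_le : ∀ s ∈ Icc (0 : ℝ) 1, ∀ t ∈ Icc (0 : ℝ) 1, g ((s + t) / 2) ≤ (g s + g t) / 2)
    {t : ℝ} (ht : t ∈ Icc (0 : ℝ) 1) : g t ≤ 0 := by
  have le_sSup (t : ℝ) (ht : t ∈ Icc (0 : ℝ) 1) : g t ≤ sSup (g '' Icc 0 1) :=
    le_csSup bdd (mem_image_of_mem g ht)
  have le_half (t : ℝ) (ht : t ∈ Icc (0 : ℝ) 1) : g t ≤ sSup (g '' Icc 0 1) / 2 := by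
    rcases le_total t 2⁻¹ with h | h
    · have double_mem : 2 * t ∈ Icc (0 : ℝ) 1 := ⟨by linarith [ht.1], by linarith⟩
      have half_le := midpoint_le 0 (by simp) _ double_mem
      rw [zero_add, mul_div_cancel_left₀ _ two_ne_zero] at half_le
      linarith [le_sSup _ double_mem]
    · have double_mem : 2 * t - 1 ∈ Icc (0 : ℝ) 1 := ⟨by linarith, by linarith [ht.2]⟩
      have half_le := midpoint_le 1 (by simp) _ double_mem
      rw [add_sub_cancel, mul_div_cancel_left₀ _ two_ne_zero] at half_le
      linarith [le_sSup _ double_mem]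
  have sSup_le := csSup_le ((nonempty_Icc.2 zero_le_one).image g) (forall_mem_image.2 le_half)
  linarith [le_sSup t ht]

theorem convexOn_of_midpoint_le {E : Type*} [AddCommGroup E] [Module ℝ E] {s : Set E} {f : E → ℝ}
    (hs : Convex ℝ s) (bdd : ∀ x ∈ s, ∀ y ∈ s, BddAbove (f '' segment ℝ x y))
    (midpoint_le : ∀ x ∈ s, ∀ y ∈ s, f (midpoint ℝ x y) ≤ (f x + f y) / 2) : ConvexOn ℝ s f := by
  refine ⟨hs, fun x hx y hy a b ha hb hab => ?_⟩
  set chord : ℝ → ℝ := fun t => (1 - t) * f x + t * f y with chord_def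
  have line_mem (t : ℝ) (ht : t ∈ Icc (0 : ℝ) 1) : AffineMap.lineMap x y t ∈ s :=
    hs.lineMap_mem hx hy ht
  have bdd_sub : BddAbove ((fun t => f (AffineMap.lineMap x y t) - chord t) '' Icc 0 1) := by
    obtain ⟨C, hC⟩ := bdd x hx y hy
    obtain ⟨K, hK⟩ := isCompact_Icc.bddBelow_image
      (f := chord) (K := Icc 0 1) (by fun_prop)
    refine ⟨C - K, forall_mem_image.2 fun t ht => sub_le_sub (hC ?_) (hK (mem_image_of_mem _ ht))⟩
    rw [segment_eq_image_lineMap]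
    exact mem_image_of_mem f (mem_image_of_mem _ ht)
  have nonpos := nonpos_of_midpoint_le (t := b) bdd_sub (by simp [chord_def]) (by simp [chord_def])
    (fun s hs t ht => ?_) ⟨hb, by linarith⟩
  · have line_eq : AffineMap.lineMap x y b = a • x + b • y := by
      rw [AffineMap.lineMap_apply_module, ← hab, add_sub_cancel_right]
    have a_eq : 1 - b = a := by linarith
    simp only [line_eq, chord_def, a_eq] at nonpos
    simp only [smul_eq_mul]
    linarith
  · have midpoint_eq : AffineMap.lineMap x y ((s + t) / 2) =
        midpoint ℝ (AffineMap.lineMap x y s : E) (AffineMap.lineMap x y t) := by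
      rw [← AffineMap.map_midpoint, midpoint_eq_smul_add, smul_eq_mul, invOf_eq_inv,
        inv_mul_eq_div]
    have main := midpoint_le _ (line_mem s hs) _ (line_mem t ht)
    rw [← midpoint_eq] at main
    simp only [chord_def]
    linarith

/-! ### The Bellman function as a minorant -/

/-- The supremum over all intervals of the lower Bellman function; passing to the supremum makes the
function on an interval comparable with the functions on its halves. -/
noncomputable def upper (m M : ℝ) (x : ℝ × ℝ × ℝ) : ℝ :=
  (⨆ (c : ℝ) (d : ℝ) (_ : c < d), Bmin c d m M x.1 x.2.1 x.2.2).toReal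

theorem upper_le {x : ℝ × ℝ × ℝ} {v : ℝ} (hv : 0 ≤ v)
    (h : ∀ c d, c < d → Bmin c d m M x.1 x.2.1 x.2.2 ≤ ENNReal.ofReal v) : upper m M x ≤ v :=
  ENNReal.toReal_le_of_le_ofReal hv (iSup_le fun c => iSup_le fun d => iSup_le (h c d))

theorem upper_nonneg (m M : ℝ) (x : ℝ × ℝ × ℝ) : 0 ≤ upper m M x := ENNReal.toReal_nonneg

theorem mul_nonneg_of_mem_domain (hm : 0 ≤ m) {x : ℝ × ℝ × ℝ} (hx : x ∈ domain m M) :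
    0 ≤ x.2.1 * x.2.2 :=
  mul_nonneg ((sq_nonneg _).trans hx.1) (hm.trans hx.2.1)

theorem upper_le_mul (hm : 0 ≤ m) {x : ℝ × ℝ × ℝ} (hx : x ∈ domain m M) :
    upper m M x ≤ x.2.1 * x.2.2 :=
  upper_le (mul_nonneg_of_mem_domain hm hx) fun _ _ hcd => Bmin_le_ofReal_mul hcd hm hx

theorem Bmin_le_ofReal_upper (hm : 0 ≤ m) {x : ℝ × ℝ × ℝ} (hx : x ∈ domain m M) {c d : ℝ}
    (hcd : c < d) : Bmin c d m M x.1 x.2.1 x.2.2 ≤ ENNReal.ofReal (upper m M x) := by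
  have sup_le : ⨆ (c : ℝ) (d : ℝ) (_ : c < d), Bmin c d m M x.1 x.2.1 x.2.2 ≤
      ENNReal.ofReal (x.2.1 * x.2.2) :=
    iSup_le fun c => iSup_le fun d => iSup_le fun hcd => Bmin_le_ofReal_mul hcd hm hx
  rw [upper, ENNReal.ofReal_toReal (sup_le.trans_lt ENNReal.ofReal_lt_top).ne]
  exact le_iSup_of_le c (le_iSup_of_le d (le_iSup_of_le hcd le_rfl))

theorem upper_midpoint_add_le (hm : 0 ≤ m) {p q : ℝ × ℝ × ℝ} (hp : p ∈ domain m M)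
    (hq : q ∈ domain m M) {a : ℝ} (ha : 0 ≤ a) (hM : (p.2.2 + q.2.2) / 2 + a ≤ M) :
    upper m M ((p.1 + q.1) / 2, (p.2.1 + q.2.1) / 2, (p.2.2 + q.2.2) / 2 + a) ≤
      (upper m M p + upper m M q) / 2 + a * ((p.1 + q.1) / 2) ^ 2 := by
  have p_nonneg := upper_nonneg m M p
  have q_nonneg := upper_nonneg m M q
  refine upper_le (by positivity) fun c d hcd => ?_
  refine (Bmin_midpoint_add_le hcd hm hp.2.1 hq.2.1 ha hM).trans ?_
  rw [ENNReal.ofReal_add (by positivity) (by positivity), ENNReal.ofReal_div_of_pos two_pos,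
    ENNReal.ofReal_add p_nonneg q_nonneg, ENNReal.ofReal_ofNat]
  gcongr
  · exact Bmin_le_ofReal_upper hm hp (left_lt_add_div_two.2 hcd)
  · exact Bmin_le_ofReal_upper hm hq (add_div_two_lt_right.2 hcd)

theorem upper_midpoint_le (hm : 0 ≤ m) {p q : ℝ × ℝ × ℝ} (hp : p ∈ domain m M)
    (hq : q ∈ domain m M) : upper m M (midpoint ℝ p q) ≤ (upper m M p + upper m M q) / 2 := by
  have midpoint_eq : midpoint ℝ p q =
      ((p.1 + q.1) / 2, (p.2.1 + q.2.1) / 2, (p.2.2 + q.2.2) / 2 + 0) := by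
    rw [midpoint_eq_smul_add]
    ext <;> simp <;> ring
  have main := upper_midpoint_add_le hm hp hq le_rfl (by linarith [hp.2.2, hq.2.2])
  rwa [← midpoint_eq, zero_mul, add_zero] at main

theorem convexOn_upper (hm : 0 ≤ m) : ConvexOn ℝ (domain m M) (upper m M) := by
  refine convexOn_of_midpoint_le (convex_domain m M) (fun p hp q hq => ?_)
    fun p hp q hq => upper_midpoint_le hm hp hq
  have segment_subset := (convex_domain m M).segment_subset hp hq
  have isCompact_segment : IsCompact (segment ℝ p q) := by
    rw [segment_eq_image_lineMap]
    exact isCompact_Icc.image (AffineMap.lineMap_continuous)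
  obtain ⟨C, hC⟩ := isCompact_segment.bddAbove_image
    (f := fun x => x.2.1 * x.2.2) (by fun_prop)
  exact ⟨C, forall_mem_image.2 fun x hx =>
    (upper_le_mul hm (segment_subset hx)).trans (hC (mem_image_of_mem _ hx))⟩

theorem isMinorant_upper (hm : 0 ≤ m) : IsMinorant m M (upper m M) where
  convexOn := convexOn_upper hm
  jump_le x₁ x₂ x₃ a hx ha hM := by
    simpa only [add_self_div_two] using
      upper_midpoint_add_le hm hx hx ha (by rwa [add_self_div_two])
  le_mul _ hx := upper_le_mul hm hx

/-- The inequality `G (k x₁, k² x₂, x₃) ≤ k² G x`, which expresses that the functional is quadratic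
in the test function. -/
def IsQuadratic (m M : ℝ) (G : ℝ × ℝ × ℝ → ℝ) : Prop :=
  ∀ k x₁ x₂ x₃ : ℝ, (x₁, x₂, x₃) ∈ domain m M →
    G (k * x₁, k ^ 2 * x₂, x₃) ≤ k ^ 2 * G (x₁, x₂, x₃)

theorem const_mul_mem_domain {x₁ x₂ x₃ : ℝ} (hx : (x₁, x₂, x₃) ∈ domain m M) (k : ℝ) :
    (k * x₁, k ^ 2 * x₂, x₃) ∈ domain m M :=
  ⟨(mul_pow k x₁ 2).trans_le (mul_le_mul_of_nonneg_left hx.1 (sq_nonneg k)), hx.2⟩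

theorem isQuadratic_upper (hm : 0 ≤ m) : IsQuadratic m M (upper m M) := by
  intro k x₁ x₂ x₃ hx
  obtain rfl | hk := eq_or_ne k 0
  · refine (upper_le_mul hm (const_mul_mem_domain hx 0)).trans_eq ?_
    simp
  · refine upper_le (mul_nonneg (sq_nonneg k) (upper_nonneg m M _)) fun c d hcd => ?_
    rw [ENNReal.ofReal_mul (sq_nonneg k)]
    exact (Bmin_const_mul_le hk).trans (by gcongr; exact Bmin_le_ofReal_upper hm hx hcd)

/-! ### The cubic equation -/

/-- The function `w`. The point `(1, w (s (M - m)), M)` is where the extremal line with parameter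
`s` meets the face `x₃ = M`. -/
noncomputable def weight (u : ℝ) : ℝ := (1 + u) ^ 2 / (1 + 2 * u)

/-- The right-hand side of the cubic equation, with `z = M - x₃`, `L = M - m` and `s = -2a`. -/
noncomputable def ratio (z L s : ℝ) : ℝ := weight (s * z) / weight (s * L)

theorem strictMonoOn_weight : StrictMonoOn weight (Ici 0) := by
  intro u (hu : 0 ≤ u) v (hv : 0 ≤ v) huv
  have gap_pos : 0 < (v - u) * (u + v + 2 * u * v) := by
    have := sub_pos.2 huv
    have := hu.trans_lt huv
    positivity
  rw [weight, weight, div_lt_div_iff₀ (by positivity) (by positivity)]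
  linarith

@[simp]
theorem weight_zero : weight 0 = 1 := by norm_num [weight]

theorem one_le_weight {u : ℝ} (hu : 0 ≤ u) : 1 ≤ weight u :=
  weight_zero.symm.trans_le (strictMonoOn_weight.monotoneOn self_mem_Ici hu hu)

@[simp]
theorem ratio_zero (z L : ℝ) : ratio z L 0 = 1 := by simp [ratio]

theorem cubic_iff_eq_ratio {x₁ x₂ x₃ a : ℝ} :
    Cubic m M x₁ x₂ x₃ a ↔ x₁ ^ 2 / x₂ = ratio (M - x₃) (M - m) (-2 * a) := by
  rw [Cubic, ratio, weight, weight, div_div_div_eq, div_pow, div_mul_div_comm]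
  ring_nf

theorem one_sub_ratio {z L s : ℝ} (hz : 0 ≤ z) (hL : 0 ≤ L) (hs : 0 ≤ s) :
    1 - ratio z L s =
      (L - z) * (s / (1 + s * L) * (1 - (1 + s * z) / (1 + 2 * (s * z)) / (1 + s * L))) := by
  rw [ratio, weight, weight]
  field_simp
  ring

theorem strictAntiOn_ratio {z L : ℝ} (hz : 0 ≤ z) (hzL : z < L) :
    StrictAntiOn (ratio z L) (Ici 0) := by
  intro s (hs : 0 ≤ s) t (ht : 0 ≤ t) hst
  have hL : 0 < L := hz.trans_lt hzL
  have first_lt : s / (1 + s * L) < t / (1 + t * L) := by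
    rw [div_lt_div_iff₀ (by positivity) (by positivity)]
    linarith
  have inner_le : (1 + t * z) / (1 + 2 * (t * z)) ≤ (1 + s * z) / (1 + 2 * (s * z)) := by
    rw [div_le_div_iff₀ (by positivity) (by positivity)]
    linarith [mul_le_mul_of_nonneg_right hst.le hz]
  have second_lt : 1 - (1 + s * z) / (1 + 2 * (s * z)) / (1 + s * L) <
      1 - (1 + t * z) / (1 + 2 * (t * z)) / (1 + t * L) := by
    refine sub_lt_sub_left ((div_le_div_of_nonneg_right inner_le (by positivity)).trans_lt ?_) 1
    gcongr
  have second_nonneg : 0 ≤ 1 - (1 + s * z) / (1 + 2 * (s * z)) / (1 + s * L) := by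
    rw [sub_nonneg, div_div]
    refine div_le_one_of_le₀ ?_ (by positivity)
    nlinarith [mul_nonneg hs hz, mul_nonneg hs hL.le,
      mul_nonneg (mul_nonneg hs hz) (mul_nonneg hs hL.le)]
  have key := mul_lt_mul_of_pos_left
    (mul_lt_mul'' first_lt second_lt (by positivity) second_nonneg) (sub_pos.2 hzL)
  rw [← one_sub_ratio hz hL.le hs, ← one_sub_ratio hz hL.le ht] at key
  linarith

theorem ratio_le {z L s : ℝ} (hz : 0 ≤ z) (hL : 0 ≤ L) (hs : 0 ≤ s) :
    ratio z L s ≤ (2 + s * z) / (1 + s * L) := by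
  have hp : 0 ≤ s * L := mul_nonneg hs hL
  have hq : 0 ≤ s * z := mul_nonneg hs hz
  have weight_le : weight (s * z) ≤ (2 + s * z) / 2 := by
    rw [weight, div_le_div_iff₀ (by positivity) two_pos]
    nlinarith
  have le_weight : (1 + s * L) / 2 ≤ weight (s * L) := by
    rw [weight, div_le_div_iff₀ two_pos (by positivity)]
    nlinarith
  calc ratio z L s ≤ (2 + s * z) / 2 / ((1 + s * L) / 2) :=
        div_le_div₀ (by positivity) weight_le (by positivity) le_weight
    _ = (2 + s * z) / (1 + s * L) := div_div_div_cancel_right₀ two_ne_zero _ _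

theorem continuousOn_ratio {z L : ℝ} (hz : 0 ≤ z) (hL : 0 ≤ L) :
    ContinuousOn (ratio z L) (Ici 0) := by
  intro s (hs : 0 ≤ s)
  unfold ratio weight
  have : (1 + s * L) ^ 2 / (1 + 2 * (s * L)) ≠ 0 := by positivity
  have : 1 + 2 * (s * z) ≠ 0 := by positivity
  have : 1 + 2 * (s * L) ≠ 0 := by positivity
  fun_prop (disch := assumption)

theorem exists_ratio_eq {z L y : ℝ} (hz : 0 ≤ z) (hL : 0 < L) (hy : z < y * L) (hy1 : y ≤ 1) :
    ∃ s, 0 ≤ s ∧ ratio z L s = y := by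
  have gap_pos : 0 < y * L - z := sub_pos.2 hy
  have y_pos : 0 < y := pos_of_mul_pos_left (hz.trans_lt hy) hL.le
  set T := 2 / (y * L - z)
  have T_pos : 0 < T := by positivity
  have ratio_T_le : ratio z L T ≤ y := by
    refine (ratio_le hz hL.le T_pos.le).trans ((div_le_iff₀ (by positivity)).2 ?_)
    have T_mul : T * (y * L - z) = 2 := div_mul_cancel₀ 2 gap_pos.ne'
    linarith
  obtain ⟨s, hs, ratio_eq⟩ := intermediate_value_Icc' T_pos.le
    ((continuousOn_ratio hz hL.le).mono Icc_subset_Ici_self)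
    ⟨ratio_T_le, hy1.trans_eq (ratio_zero z L).symm⟩
  exact ⟨s, hs.1, ratio_eq⟩

theorem lt_of_steep {x₁ x₂ x₃ : ℝ} (hx : (x₁, x₂, x₃) ∈ domain m M) (hx₂ : 0 < x₂)
    (steep : (M - x₃) * x₂ < (M - m) * x₁ ^ 2) : m < x₃ := by
  have hmM : 0 ≤ M - m := sub_nonneg.2 (hx.2.1.trans hx.2.2)
  have := steep.trans_le (mul_le_mul_of_nonneg_left hx.1 hmM)
  linarith [lt_of_mul_lt_mul_right this hx₂.le]

theorem exists_cubic_iff {x₁ x₂ x₃ : ℝ} (hx : (x₁, x₂, x₃) ∈ domain m M) (hx₂ : 0 < x₂)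
    (steep : (M - x₃) * x₂ < (M - m) * x₁ ^ 2) :
    ∃ a ≤ 0, (∀ b ≤ 0, Cubic m M x₁ x₂ x₃ b ↔ b = a) ∧
      (x₁ ^ 2 < x₂ → a < 0) ∧ (x₁ ^ 2 = x₂ → a = 0) := by
  have ⟨hx₁, _, h₃M⟩ : x₁ ^ 2 ≤ x₂ ∧ m ≤ x₃ ∧ x₃ ≤ M := hx
  have hz : 0 ≤ M - x₃ := sub_nonneg.2 h₃M
  have hzL : M - x₃ < M - m := sub_lt_sub_left (lt_of_steep hx hx₂ steep) M
  obtain ⟨s, hs, ratio_eq⟩ := exists_ratio_eq hz (hz.trans_lt hzL) (y := x₁ ^ 2 / x₂)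
    (by rwa [div_mul_eq_mul_div, lt_div_iff₀ hx₂, mul_comm (x₁ ^ 2)]) ((div_le_one hx₂).2 hx₁)
  have cubic_iff (b : ℝ) (hb : b ≤ 0) : Cubic m M x₁ x₂ x₃ b ↔ b = -s / 2 := by
    rw [cubic_iff_eq_ratio, ← ratio_eq,
      (strictAntiOn_ratio hz hzL).injOn.eq_iff hs (mem_Ici.2 (by linarith))]
    constructor <;> intro h <;> linarith
  have zero_iff : x₁ ^ 2 = x₂ ↔ 0 = -s / 2 := by
    rw [← cubic_iff 0 le_rfl, cubic_iff_eq_ratio, mul_zero, ratio_zero, div_eq_one_iff_eq hx₂.ne']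
  have root_nonpos : -s / 2 ≤ 0 := by linarith
  exact ⟨-s / 2, root_nonpos, cubic_iff,
    fun hlt => root_nonpos.lt_of_ne fun h => hlt.ne (zero_iff.2 h.symm),
    fun heq => (zero_iff.1 heq).symm⟩

/-! ### The extremal lines -/

/-- The point with `x₃ = M - z` on the extremal line with parameters `s` and `k`. As `z` runs over
`[0, M - m]`, it moves from `(k, k² w (s (M - m)), M)` to `(u, u², m)` with `u = k (1 + s (M - m))`,
and the Bellman function is affine along the way. -/
noncomputable def extremal (m M s k z : ℝ) : ℝ × ℝ × ℝ :=
  (k * (1 + s * z), k ^ 2 * weight (s * (M - m)) * (1 + 2 * (s * z)), M - z)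

theorem B_extremal {s z : ℝ} (hs : 0 ≤ s) (hz : 0 ≤ z) (hmM : m ≤ M) (k : ℝ) :
    B m M (extremal m M s k z).2.1 (extremal m M s k z).2.2 (-s / 2) =
      k ^ 2 * (M - m - z) / (1 + 2 * (s * (M - m))) + m * (extremal m M s k z).2.1 := by
  have hL : 0 ≤ M - m := sub_nonneg.2 hmM
  have linear_eq : 1 - 2 * (-s / 2) * (M - m) = 1 + s * (M - m) := by ring
  have double_eq : 1 - 4 * (-s / 2) * z = 1 + 2 * (s * z) := by ring
  simp only [B, extremal, weight, sub_sub_cancel, linear_eq, double_eq, sub_right_comm M z m]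
  field_simp

theorem exists_extremal_eq {x₁ x₂ x₃ s : ℝ} (hx₂ : 0 < x₂) (hs : 0 ≤ s) (hm₃ : m ≤ x₃)
    (h₃M : x₃ ≤ M) (h : x₁ ^ 2 / x₂ = ratio (M - x₃) (M - m) s) :
    ∃ k, extremal m M s k (M - x₃) = (x₁, x₂, x₃) := by
  have hz : 0 ≤ M - x₃ := sub_nonneg.2 h₃M
  have hL : 0 ≤ M - m := sub_nonneg.2 (hm₃.trans h₃M)
  refine ⟨x₁ / (1 + s * (M - x₃)), ?_⟩
  have weight_pos := one_pos.trans_le (one_le_weight (mul_nonneg hs hL))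
  rw [ratio, div_eq_div_iff hx₂.ne' weight_pos.ne'] at h
  have second_eq : (x₁ / (1 + s * (M - x₃))) ^ 2 * weight (s * (M - m)) *
      (1 + 2 * (s * (M - x₃))) = x₂ := by
    rw [div_pow, div_mul_eq_mul_div, h, weight]
    field_simp
  rw [extremal, second_eq, div_mul_cancel₀ _ (by positivity), sub_sub_cancel]

/-! ### Upper bounds for quadratic minorants -/

section Upper

variable {G : ℝ × ℝ × ℝ → ℝ}

theorem IsMinorant.apply_top_mul_le_of_eq (hG : IsMinorant m M G) (hQ : IsQuadratic m M G)
    (hmM : m ≤ M) {r η q : ℝ} (hr : 1 ≤ r) (hη : 0 < η)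
    (h : r * (1 + 2 * q - η * q ^ 2) = (1 + q) ^ 2) :
    G (1, r, M) * (1 + 2 * q - η * q ^ 2) ≤ M - m + m * (1 + q) ^ 2 := by
  have top_mem : (1, r, M) ∈ domain m M := ⟨by simpa using hr, hmM, le_rfl⟩
  have bottom_mem : (1 + q, (1 + q) ^ 2, m) ∈ domain m M := ⟨le_rfl, le_rfl, hmM⟩
  have scaled_mem := const_mul_mem_domain top_mem (1 - η * q)
  set θ := η / (1 + η) with θ_def
  have one_sub_θ : 1 - θ = 1 / (1 + η) := by rw [θ_def]; field_simp; ring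
  have θ_nonneg : 0 ≤ θ := by positivity
  have one_sub_θ_nonneg : 0 ≤ 1 - θ := by rw [one_sub_θ]; positivity
  have combination_eq : (1 - θ) • ((1 - η * q) * 1, (1 - η * q) ^ 2 * r, M) +
      θ • (1 + q, (1 + q) ^ 2, m) = ((1, r, M - θ * (M - m)) : ℝ × ℝ × ℝ) := by
    ext <;> simp only [Prod.smul_mk, Prod.mk_add_mk, smul_eq_mul]
    · rw [one_sub_θ, θ_def]; field_simp; ring
    · rw [one_sub_θ, θ_def, ← h]; field_simp; ring
    · ring
  have chord_le := hG.convexOn.2 scaled_mem bottom_mem one_sub_θ_nonneg θ_nonneg (by ring)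
  have combination_mem := (convex_domain m M) scaled_mem bottom_mem one_sub_θ_nonneg θ_nonneg
    (by ring)
  rw [combination_eq] at chord_le combination_mem
  have drop_nonneg : 0 ≤ θ * (M - m) := mul_nonneg θ_nonneg (sub_nonneg.2 hmM)
  have jump := hG.jump_le _ _ _ _ combination_mem drop_nonneg (by rw [sub_add_cancel])
  rw [sub_add_cancel] at jump
  have scaled_le := mul_le_mul_of_nonneg_left (hQ (1 - η * q) 1 r M top_mem) one_sub_θ_nonneg
  have bottom_le := mul_le_mul_of_nonneg_left (hG.le_mul _ bottom_mem) θ_nonneg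
  simp only [smul_eq_mul] at chord_le
  have closed : G (1, r, M) ≤ (1 - θ) * ((1 - η * q) ^ 2 * G (1, r, M)) +
      θ * (M - m + m * (1 + q) ^ 2) := by linarith
  rw [one_sub_θ, θ_def, div_mul_eq_mul_div, div_mul_eq_mul_div, ← add_div,
    le_div_iff₀ (by positivity)] at closed
  refine le_of_mul_le_mul_left ?_ hη
  linarith

theorem IsMinorant.apply_top_mul_le (hG : IsMinorant m M G) (hQ : IsQuadratic m M G)
    (hmM : m ≤ M) {p : ℝ} (hp : 0 ≤ p) :
    G (1, weight p, M) * (1 + 2 * p) ≤ M - m + m * (1 + p) ^ 2 := by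
  rcases hp.eq_or_lt with rfl | hp
  · have corner_le := hG.le_mul (1, weight 0, M) ⟨by simp, hmM, le_rfl⟩
    simp only [weight_zero, one_mul] at corner_le ⊢
    linarith
  have weight_pos : 0 < weight p := one_pos.trans_le (one_le_weight hp.le)
  have below (q : ℝ) (hq : q ∈ Ioo 0 p) :
      G (1, weight p, M) * ((1 + q) ^ 2 / weight p) ≤ M - m + m * (1 + q) ^ 2 := by
    have q_pos : 0 < q := hq.1
    set η := (1 + 2 * q - (1 + q) ^ 2 / weight p) / q ^ 2 with η_def
    have η_mul : 1 + 2 * q - η * q ^ 2 = (1 + q) ^ 2 / weight p := by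
      rw [η_def, div_mul_cancel₀ _ (by positivity), sub_sub_cancel]
    have η_pos : 0 < η := by
      have weight_lt : (1 + q) ^ 2 / (1 + 2 * q) < weight p :=
        strictMonoOn_weight q_pos.le hp.le hq.2
      rw [div_lt_iff₀ (by positivity), ← div_lt_iff₀' weight_pos] at weight_lt
      exact div_pos (sub_pos.2 weight_lt) (by positivity)
    rw [← η_mul]
    refine hG.apply_top_mul_le_of_eq hQ hmM (one_le_weight hp.le) η_pos ?_
    rw [η_mul, mul_div_cancel₀ _ weight_pos.ne']
  have limit_eq : 1 + 2 * p = (1 + p) ^ 2 / weight p := by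
    rw [weight, div_div_cancel₀ (by positivity)]
  rw [limit_eq]
  have tendsto_lhs : Tendsto (fun q => G (1, weight p, M) * ((1 + q) ^ 2 / weight p)) (𝓝[<] p)
      (𝓝 (G (1, weight p, M) * ((1 + p) ^ 2 / weight p))) :=
    Continuous.tendsto' (by fun_prop) _ _ rfl |>.mono_left nhdsWithin_le_nhds
  have tendsto_rhs : Tendsto (fun q => M - m + m * (1 + q) ^ 2) (𝓝[<] p)
      (𝓝 (M - m + m * (1 + p) ^ 2)) :=
    Continuous.tendsto' (by fun_prop) _ _ rfl |>.mono_left nhdsWithin_le_nhds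
  exact le_of_tendsto_of_tendsto tendsto_lhs tendsto_rhs
    (eventually_of_mem (Ioo_mem_nhdsLT hp) below)

theorem IsMinorant.apply_extremal_le (hG : IsMinorant m M G) (hQ : IsQuadratic m M G)
    (hmM : m < M) {s z : ℝ} (hs : 0 ≤ s) (hz : 0 ≤ z) (hzL : z ≤ M - m) (k : ℝ) :
    G (extremal m M s k z) ≤
      B m M (extremal m M s k z).2.1 (extremal m M s k z).2.2 (-s / 2) := by
  have hL : 0 < M - m := sub_pos.2 hmM
  have hp : 0 ≤ s * (M - m) := mul_nonneg hs hL.le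
  have top_mem : (1, weight (s * (M - m)), M) ∈ domain m M :=
    ⟨(one_pow 2).trans_le (one_le_weight hp), hmM.le, le_rfl⟩
  set u := k * (1 + s * (M - m)) with u_def
  have bottom_mem : (u, u ^ 2, m) ∈ domain m M := ⟨le_rfl, le_rfl, hmM.le⟩
  have θ_nonneg : 0 ≤ z / (M - m) := by positivity
  have one_sub_θ_nonneg : 0 ≤ 1 - z / (M - m) := sub_nonneg.2 ((div_le_one hL).2 hzL)
  have combination_eq : (1 - z / (M - m)) • (k * 1, k ^ 2 * weight (s * (M - m)), M) +
      (z / (M - m)) • (u, u ^ 2, m) = extremal m M s k z := by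
    ext <;> simp only [Prod.smul_mk, Prod.mk_add_mk, smul_eq_mul, extremal, u_def, weight] <;>
      field_simp <;> ring
  have chord_le := hG.convexOn.2 (const_mul_mem_domain top_mem k) bottom_mem one_sub_θ_nonneg
    θ_nonneg (by ring)
  rw [combination_eq] at chord_le
  have top_le := hG.apply_top_mul_le hQ hmM.le hp
  rw [← le_div_iff₀ (by positivity)] at top_le
  rw [B_extremal hs hz hmM.le]
  calc G (extremal m M s k z)
      ≤ (1 - z / (M - m)) * (k ^ 2 * ((M - m + m * (1 + s * (M - m)) ^ 2) /
          (1 + 2 * (s * (M - m))))) + z / (M - m) * (u ^ 2 * m) := by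
        refine chord_le.trans (add_le_add (mul_le_mul_of_nonneg_left ?_ one_sub_θ_nonneg)
          (mul_le_mul_of_nonneg_left (hG.le_mul _ bottom_mem) θ_nonneg))
        exact (hQ k _ _ _ top_mem).trans (mul_le_mul_of_nonneg_left top_le (sq_nonneg k))
    _ = k ^ 2 * (M - m - z) / (1 + 2 * (s * (M - m))) + m * (extremal m M s k z).2.1 := by
        simp only [extremal, u_def, weight]
        field_simp
        ring

theorem IsMinorant.apply_zero_le (hG : IsMinorant m M G) {x₂ x₃ : ℝ} (hx₂ : 0 ≤ x₂)
    (hm₃ : m ≤ x₃) (h₃M : x₃ ≤ M) : G (0, x₂, x₃) ≤ m * x₂ := by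
  have bottom_mem : (0, x₂, m) ∈ domain m M := ⟨by simpa using hx₂, le_rfl, hm₃.trans h₃M⟩
  have jump := hG.jump_le 0 x₂ m (x₃ - m) bottom_mem (sub_nonneg.2 hm₃) (by linarith)
  rw [add_sub_cancel] at jump
  linarith [hG.le_mul _ bottom_mem]

theorem IsMinorant.apply_le_of_flat (hG : IsMinorant m M G) {x₁ x₂ x₃ : ℝ}
    (hx : (x₁, x₂, x₃) ∈ domain m M) (flat : (M - m) * x₁ ^ 2 ≤ (M - x₃) * x₂) :
    G (x₁, x₂, x₃) ≤ m * x₂ := by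
  have ⟨hx₁, hm₃, h₃M⟩ : x₁ ^ 2 ≤ x₂ ∧ m ≤ x₃ ∧ x₃ ≤ M := hx
  have hx₂ : 0 ≤ x₂ := (sq_nonneg x₁).trans hx₁
  rcases hm₃.eq_or_lt with rfl | hm₃
  · exact (hG.le_mul _ hx).trans_eq (mul_comm _ _)
  rcases eq_or_ne x₁ 0 with rfl | x₁_ne
  · exact hG.apply_zero_le hx₂ hm₃.le h₃M
  have hL : 0 < M - m := by linarith
  have hz : 0 < M - x₃ :=
    pos_of_mul_pos_left ((by positivity : 0 < (M - m) * x₁ ^ 2).trans_le flat) hx₂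
  set θ := (M - x₃) / (M - m) with θ_def
  have θ_pos : 0 < θ := by positivity
  have one_sub_θ_nonneg : 0 ≤ 1 - θ := sub_nonneg.2 ((div_le_one hL).2 (by linarith))
  have bottom_mem : (x₁ / θ, x₂ / θ, m) ∈ domain m M := by
    refine ⟨?_, le_rfl, hm₃.le.trans h₃M⟩
    have sq_le : x₁ ^ 2 ≤ θ * x₂ := by
      rwa [θ_def, div_mul_eq_mul_div, le_div_iff₀' hL]
    rw [div_pow, div_le_div_iff₀ (by positivity) θ_pos]
    linarith [mul_le_mul_of_nonneg_right sq_le θ_pos.le]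
  have top_mem : (0, 0, M) ∈ domain m M := ⟨by simp, hm₃.le.trans h₃M, le_rfl⟩
  have chord_le := hG.convexOn.2 top_mem bottom_mem one_sub_θ_nonneg θ_pos.le (by ring)
  have combination_eq : (1 - θ) • (0, 0, M) + θ • (x₁ / θ, x₂ / θ, m) =
      ((x₁, x₂, x₃) : ℝ × ℝ × ℝ) := by
    ext <;> simp only [Prod.smul_mk, Prod.mk_add_mk, smul_eq_mul, mul_zero, zero_add,
      mul_div_cancel₀ _ θ_pos.ne']
    rw [θ_def]
    field_simp
    ring
  rw [combination_eq] at chord_le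
  calc G (x₁, x₂, x₃) ≤ (1 - θ) * (0 * M) + θ * (x₂ / θ * m) :=
        chord_le.trans (add_le_add
          (mul_le_mul_of_nonneg_left (hG.le_mul _ top_mem) one_sub_θ_nonneg)
          (mul_le_mul_of_nonneg_left (hG.le_mul _ bottom_mem) θ_pos.le))
    _ = m * x₂ := by field_simp; ring

end Upper

/-! ### Minorants tangent to the Bellman function -/

theorem isMinorant_const_mul (m M : ℝ) : IsMinorant m M fun x => m * x.2.1 where
  convexOn := by
    refine ⟨convex_domain m M, fun p _ q _ a b _ _ _ => le_of_eq ?_⟩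
    simp only [Prod.fst_add, Prod.snd_add, Prod.smul_fst, Prod.smul_snd, smul_eq_mul]
    ring
  jump_le _ _ _ _ _ ha _ := le_add_of_nonneg_right (by positivity)
  le_mul x hx := by
    rw [mul_comm]
    exact mul_le_mul_of_nonneg_left hx.2.1 ((sq_nonneg _).trans hx.1)

/-- The minorant supporting the Bellman function along the extremal lines with parameter `s > 0`. -/
noncomputable def minorant (m M s : ℝ) (x : ℝ × ℝ × ℝ) : ℝ :=
  m * x.2.1 + (x.1 ^ 2 / (1 + s * (M - x.2.2)) - x.2.1 / (1 + s * (M - m))) / s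

theorem convexOn_sq_div : ConvexOn ℝ {x : ℝ × ℝ | 0 < x.2} fun x => x.1 ^ 2 / x.2 := by
  have convex_pos : Convex ℝ {x : ℝ × ℝ | 0 < x.2} :=
    (convex_Ioi (0 : ℝ)).linear_preimage (LinearMap.snd ℝ ℝ ℝ)
  refine ⟨convex_pos, fun p (hp : 0 < p.2) q (hq : 0 < q.2) a b ha hb hab => ?_⟩
  have denominator_pos : 0 < a * p.2 + b * q.2 := convex_pos hp hq ha hb hab
  have gap_nonneg : 0 ≤ a * b * (p.1 * q.2 - q.1 * p.2) ^ 2 / (p.2 * q.2) := by positivity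
  have gap_eq : a * b * (p.1 * q.2 - q.1 * p.2) ^ 2 / (p.2 * q.2) =
      (a * (p.1 ^ 2 / p.2) + b * (q.1 ^ 2 / q.2)) * (a * p.2 + b * q.2) -
        (a * p.1 + b * q.1) ^ 2 := by
    field_simp
    ring
  simp only [Prod.fst_add, Prod.snd_add, Prod.smul_fst, Prod.smul_snd, smul_eq_mul]
  rw [div_le_iff₀ denominator_pos]
  linarith

theorem convexOn_minorant {s : ℝ} (hs : 0 < s) : ConvexOn ℝ (domain m M) (minorant m M s) := by
  refine ⟨convex_domain m M, fun p hp q hq a b ha hb hab => ?_⟩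
  have denominator_pos (x : ℝ × ℝ × ℝ) (hx : x ∈ domain m M) : 0 < 1 + s * (M - x.2.2) := by
    have := sub_nonneg.2 hx.2.2
    positivity
  have sq_div_le := convexOn_sq_div.2 (x := (p.1, 1 + s * (M - p.2.2)))
    (y := (q.1, 1 + s * (M - q.2.2))) (denominator_pos p hp) (denominator_pos q hq) ha hb hab
  have denominator_eq : a * (1 + s * (M - p.2.2)) + b * (1 + s * (M - q.2.2)) =
      1 + s * (M - (a * p.2.2 + b * q.2.2)) := by
    linear_combination (1 + s * M) * hab
  simp only [Prod.smul_mk, Prod.mk_add_mk, smul_eq_mul, denominator_eq] at sq_div_le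
  simp only [minorant, Prod.fst_add, Prod.snd_add, Prod.smul_fst, Prod.smul_snd, smul_eq_mul]
  have scaled := div_le_div_of_nonneg_right sq_div_le hs.le
  simp only [sub_div, add_div] at scaled ⊢
  ring_nf at scaled ⊢
  linarith

theorem inv_sub_le_inv_add {A t : ℝ} (ht : 0 ≤ t) (h : 1 ≤ A - t) : (A - t)⁻¹ ≤ A⁻¹ + t := by
  have hA : 1 ≤ A := by linarith
  rw [← sub_le_iff_le_add', inv_sub_inv (by positivity) (by positivity), sub_sub_cancel]
  exact div_le_self ht (one_le_mul_of_one_le_of_one_le h hA)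

theorem minorant_le_mul {s : ℝ} (hs : 0 < s) {x : ℝ × ℝ × ℝ} (hx : x ∈ domain m M) :
    minorant m M s x ≤ x.2.1 * x.2.2 := by
  obtain ⟨hx₁, hm₃, h₃M⟩ : x.1 ^ 2 ≤ x.2.1 ∧ m ≤ x.2.2 ∧ x.2.2 ≤ M := hx
  have hx₂ : 0 ≤ x.2.1 := (sq_nonneg _).trans hx₁
  have numerator_nonneg : 0 ≤ x.2.1 * (x.2.2 - m) := mul_nonneg hx₂ (sub_nonneg.2 hm₃)
  have one_le_z : 1 ≤ 1 + s * (M - x.2.2) :=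
    le_add_of_nonneg_right (mul_nonneg hs.le (sub_nonneg.2 h₃M))
  have one_le_L : 1 ≤ 1 + s * (M - m) :=
    le_add_of_nonneg_right (mul_nonneg hs.le (sub_nonneg.2 (hm₃.trans h₃M)))
  have difference_le : (x.1 ^ 2 / (1 + s * (M - x.2.2)) - x.2.1 / (1 + s * (M - m))) / s ≤
      x.2.1 * (x.2.2 - m) :=
    calc (x.1 ^ 2 / (1 + s * (M - x.2.2)) - x.2.1 / (1 + s * (M - m))) / s
        ≤ (x.2.1 / (1 + s * (M - x.2.2)) - x.2.1 / (1 + s * (M - m))) / s := by gcongr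
      _ = x.2.1 * (x.2.2 - m) / ((1 + s * (M - x.2.2)) * (1 + s * (M - m))) := by
        field_simp
        ring
      _ ≤ x.2.1 * (x.2.2 - m) :=
        div_le_self numerator_nonneg (one_le_mul_of_one_le_of_one_le one_le_z one_le_L)
  rw [minorant]
  linarith

theorem isMinorant_minorant {s : ℝ} (hs : 0 < s) : IsMinorant m M (minorant m M s) where
  convexOn := convexOn_minorant hs
  jump_le x₁ x₂ x₃ a _ ha hM := by
    have inv_le := inv_sub_le_inv_add (A := 1 + s * (M - x₃)) (mul_nonneg hs.le ha)
      (by linarith [mul_nonneg hs.le (sub_nonneg.2 hM)])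
    have denominator_eq : 1 + s * (M - x₃) - s * a = 1 + s * (M - (x₃ + a)) := by ring
    rw [denominator_eq] at inv_le
    have scaled :=
      div_le_div_of_nonneg_right (mul_le_mul_of_nonneg_left inv_le (sq_nonneg x₁)) hs.le
    have term_eq : x₁ ^ 2 * ((1 + s * (M - x₃))⁻¹ + s * a) / s =
        x₁ ^ 2 * (1 + s * (M - x₃))⁻¹ / s + a * x₁ ^ 2 := by
      field_simp
    rw [term_eq] at scaled
    simp only [minorant, div_eq_mul_inv (x₁ ^ 2), sub_div]
    linarith
  le_mul _ hx := minorant_le_mul hs hx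

theorem minorant_extremal {s z : ℝ} (hs : 0 < s) (hz : 0 ≤ z) (hmM : m ≤ M) (k : ℝ) :
    minorant m M s (extremal m M s k z) =
      B m M (extremal m M s k z).2.1 (extremal m M s k z).2.2 (-s / 2) := by
  have hL : 0 ≤ M - m := sub_nonneg.2 hmM
  rw [B_extremal hs.le hz hmM]
  simp only [minorant, extremal, weight, sub_sub_cancel]
  field_simp
  ring

theorem tendsto_minorant_diagonal {v y : ℝ} (hmy : m ≤ y) (hyM : y ≤ M) :
    Tendsto (fun s => minorant m M s (v, v ^ 2, y)) (𝓝[>] 0) (𝓝 (v ^ 2 * y)) := by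
  have tendsto_closed : Tendsto (fun s => m * v ^ 2 +
      v ^ 2 * (y - m) / ((1 + s * (M - y)) * (1 + s * (M - m)))) (𝓝[>] 0) (𝓝 (v ^ 2 * y)) := by
    have continuousAt_zero : ContinuousAt (fun s => m * v ^ 2 +
        v ^ 2 * (y - m) / ((1 + s * (M - y)) * (1 + s * (M - m)))) 0 := by
      fun_prop (disch := norm_num)
    have value_eq : m * v ^ 2 + v ^ 2 * (y - m) / ((1 + 0 * (M - y)) * (1 + 0 * (M - m))) =
        v ^ 2 * y := by
      simp only [zero_mul, add_zero, one_mul, div_one]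
      ring
    exact value_eq ▸ continuousAt_zero.tendsto.mono_left nhdsWithin_le_nhds
  refine tendsto_closed.congr' ?_
  filter_upwards [self_mem_nhdsWithin] with s (hs : 0 < s)
  have hz : 0 ≤ M - y := sub_nonneg.2 hyM
  have hL : 0 ≤ M - m := sub_nonneg.2 (hmy.trans hyM)
  rw [minorant]
  field_simp
  ring

/-! ### The Bellman function -/

section Bellman

variable {c d x₁ x₂ x₃ : ℝ}

theorem ofReal_const_mul_le_Bmin (hm : 0 ≤ m) (hcd : c < d) (hx : (x₁, x₂, x₃) ∈ domain m M) :
    ENNReal.ofReal (m * x₂) ≤ Bmin c d m M x₁ x₂ x₃ :=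
  (isMinorant_const_mul m M).ofReal_le_Bmin hm hcd hx

theorem ofReal_B_le_Bmin_of_cubic (hm : 0 ≤ m) (hcd : c < d) (hx : (x₁, x₂, x₃) ∈ domain m M)
    (hx₂ : 0 < x₂) {a : ℝ} (ha : a ≤ 0) (cubic : Cubic m M x₁ x₂ x₃ a) :
    ENNReal.ofReal (B m M x₂ x₃ a) ≤ Bmin c d m M x₁ x₂ x₃ := by
  have ⟨_, hm₃, h₃M⟩ : x₁ ^ 2 ≤ x₂ ∧ m ≤ x₃ ∧ x₃ ≤ M := hx
  rw [cubic_iff_eq_ratio] at cubic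
  rcases ha.eq_or_lt with rfl | ha
  · rw [mul_zero, ratio_zero, div_eq_one_iff_eq hx₂.ne'] at cubic
    subst cubic
    have B_zero : B m M (x₁ ^ 2) x₃ 0 = x₁ ^ 2 * x₃ := by
      simp [B]
      ring
    rw [B_zero]
    refine le_of_tendsto (ENNReal.tendsto_ofReal (tendsto_minorant_diagonal hm₃ h₃M)) ?_
    filter_upwards [self_mem_nhdsWithin] with s hs
    exact (isMinorant_minorant hs).ofReal_le_Bmin hm hcd hx
  · have hs : 0 < -2 * a := by linarith
    obtain ⟨k, point_eq⟩ := exists_extremal_eq hx₂ hs.le hm₃ h₃M cubic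
    have value_eq := minorant_extremal hs (sub_nonneg.2 h₃M) (hm₃.trans h₃M) k
    rw [point_eq, neg_mul, neg_neg, mul_div_cancel_left₀ _ two_ne_zero] at value_eq
    rw [← value_eq]
    exact (isMinorant_minorant (by linarith)).ofReal_le_Bmin hm hcd hx

theorem Bmin_le_ofReal_B_of_cubic (hm : 0 ≤ m) (hcd : c < d) (hx : (x₁, x₂, x₃) ∈ domain m M)
    (hx₂ : 0 < x₂) (hmM : m < M) {a : ℝ} (ha : a ≤ 0) (cubic : Cubic m M x₁ x₂ x₃ a) :
    Bmin c d m M x₁ x₂ x₃ ≤ ENNReal.ofReal (B m M x₂ x₃ a) := by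
  have ⟨_, hm₃, h₃M⟩ : x₁ ^ 2 ≤ x₂ ∧ m ≤ x₃ ∧ x₃ ≤ M := hx
  have hs : 0 ≤ -2 * a := by linarith
  obtain ⟨k, point_eq⟩ := exists_extremal_eq hx₂ hs hm₃ h₃M (cubic_iff_eq_ratio.1 cubic)
  have upper_le := (isMinorant_upper hm).apply_extremal_le (isQuadratic_upper hm) hmM hs
    (sub_nonneg.2 h₃M) (sub_le_sub_left hm₃ M) k
  rw [point_eq, neg_mul, neg_neg, mul_div_cancel_left₀ _ two_ne_zero] at upper_le
  exact (Bmin_le_ofReal_upper hm hx hcd).trans (ENNReal.ofReal_le_ofReal upper_le)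

theorem Bmin_eq_ofReal_B_of_cubic (hm : 0 ≤ m) (hcd : c < d) (hx : (x₁, x₂, x₃) ∈ domain m M)
    (hx₂ : 0 < x₂) (hmM : m < M) {a : ℝ} (ha : a ≤ 0) (cubic : Cubic m M x₁ x₂ x₃ a) :
    Bmin c d m M x₁ x₂ x₃ = ENNReal.ofReal (B m M x₂ x₃ a) :=
  (Bmin_le_ofReal_B_of_cubic hm hcd hx hx₂ hmM ha cubic).antisymm
    (ofReal_B_le_Bmin_of_cubic hm hcd hx hx₂ ha cubic)

theorem Bmin_eq_of_flat (hm : 0 ≤ m) (hcd : c < d) (hx : (x₁, x₂, x₃) ∈ domain m M)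
    (flat : (M - m) * x₁ ^ 2 ≤ (M - x₃) * x₂) :
    Bmin c d m M x₁ x₂ x₃ = ENNReal.ofReal (m * x₂) :=
  ((Bmin_le_ofReal_upper hm hx hcd).trans
    (ENNReal.ofReal_le_ofReal ((isMinorant_upper hm).apply_le_of_flat hx flat))).antisymm
    (ofReal_const_mul_le_Bmin hm hcd hx)

theorem sub_mul_div_lt_iff (hx₂ : 0 < x₂) :
    M - (M - m) * (x₁ ^ 2 / x₂) < x₃ ↔ (M - x₃) * x₂ < (M - m) * x₁ ^ 2 := by
  rw [← mul_div_assoc, sub_lt_comm, lt_div_iff₀ hx₂]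

end Bellman

end CarlesonBellman

theorem mainTheorem3 (c d : ℝ) (hcd : c < d) (m M : ℝ) (hm : 0 ≤ m)
    (x₁ x₂ x₃ : ℝ) (hx : x₁ ^ 2 ≤ x₂) (hm3 : m ≤ x₃) (h3M : x₃ ≤ M) :
    (0 < x₂ → M - (M - m) * (x₁ ^ 2 / x₂) < x₃ →
      ∃ a : ℝ, a ≤ 0 ∧
        (∀ b : ℝ, b ≤ 0 → (CarlesonBellman.Cubic m M x₁ x₂ x₃ b ↔ b = a)) ∧
        (x₁ ^ 2 < x₂ → a < 0) ∧ (x₁ ^ 2 = x₂ → a = 0) ∧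
        CarlesonBellman.Bmin c d m M x₁ x₂ x₃ =
          ENNReal.ofReal (CarlesonBellman.B m M x₂ x₃ a)) ∧
    (0 < x₂ → x₃ ≤ M - (M - m) * (x₁ ^ 2 / x₂) →
      CarlesonBellman.Bmin c d m M x₁ x₂ x₃ = ENNReal.ofReal (m * x₂)) ∧
    (x₂ = 0 → CarlesonBellman.Bmin c d m M x₁ x₂ x₃ = 0) := by
  have mem : (x₁, x₂, x₃) ∈ CarlesonBellman.domain m M := ⟨hx, hm3, h3M⟩
  refine ⟨fun hx₂ h => ?_, fun hx₂ h => ?_, fun hx₂ => ?_⟩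
  · have steep := (CarlesonBellman.sub_mul_div_lt_iff hx₂).1 h
    have hmM := (CarlesonBellman.lt_of_steep mem hx₂ steep).trans_le h3M
    obtain ⟨a, ha, cubic_iff, neg, eq_zero⟩ := CarlesonBellman.exists_cubic_iff mem hx₂ steep
    exact ⟨a, ha, cubic_iff, neg, eq_zero, CarlesonBellman.Bmin_eq_ofReal_B_of_cubic hm hcd mem hx₂
      hmM ha ((cubic_iff a ha).2 rfl)⟩
  · exact CarlesonBellman.Bmin_eq_of_flat hm hcd mem
      (not_lt.1 ((CarlesonBellman.sub_mul_div_lt_iff hx₂).not.1 h.not_gt))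
  · subst hx₂
    simpa using CarlesonBellman.Bmin_le_ofReal_mul hcd hm mem
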